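/- A finite extensive-form game is $\Gamma=\langle N,A,H,Z,P,\sigma_c,u,\mathcal I\rangle$: players $N$, finite action set $A$, finite prefix-closed set $H\ni\varnothing$ of histories (finite sequences of actions), available actions $A(h)=\{a: ha\in H\}$, terminal histories $Z$, player function $P$ (values in $N\cup\{c\}$, $c$ being chance), chance probabilities $\sigma_c$, utilities $u_i:Z\to\mathbb R$, and for each player $i$ a partition $\mathcal I_i$ of $H_i=\{h\in H\setminus Z: P(h)=i\}$ into information sets $I$ on which $A(h)=:A(I)$ is constant. It is assumed that no information set contains two distinct histories one of which is a prefix of the other ($\sqsubseteq$ denotes the prefix relation). $X_i(h,h')$ is the sequence of pairs (information set, action) of player $i$ met from $h$ to $h'$, $X_i(h)=X_i(\varnothing,h)$, and $X_{-i}(h)$ is the analogous sequence for all players other than $i$ (chance excluded). The game has perfect recall if $X_i(h)=X_i(h')$ for all $i$, $I\in\mathcal I_i$, $h,h'\in I$. A perfect recall refinement of $\Gamma$ is a game $\check\Gamma$ with perfect recall that differs from $\Gamma$ only in its information sets $\check{\mathcal I}_i$, each of which is contained in a set of $\mathcal I_i$; for $I\in\mathcal I_i$ put $\check{\mathcal P}(I)=\{\check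 I\in\check{\mathcal I}_i:\check I\subseteq I\}$. For a set $S$ of histories let $Z_S$ be the set of terminal histories with a prefix in $S$, $z[S]$ that prefix (unique if $S$ is an information set), and $D_i(S)=\{J\in\mathcal I_i:\exists h\in S,\ h'\in J,\ h\sqsubseteq h'\}$. Let $\pi_c(z)$ be the product of chance's probabilities along $z$. $\Gamma$ is nearly well-formed with respect to a perfect recall refinement $\check\Gamma$, with constants $k_{\check I,\check I'},\ell_{\check I,\check I'}\in[0,\infty)$, if for all $i\in N$, $I\in\mathcal I_i$ and $\check I,\check I'\in\check{\mathcal P}(I)$ there are bijections $\phi:Z_{\check I}\to Z_{\check I'}$, $\psi:D_i(\check I)\to D_i(\check I')$ and, for each $J\in D_i(\check I)$, $\omega_J:A(J)\to A(\psi(J))$, where $\omega_I$ is the identity of $A(I)$, such that for all $z\in Z_{\check I}$: (i) $u_i(z)=k_{\check I,\check I'}\,u_i(\phi(z))$; (ii) $\pi_c(z)=\ell_{\check I,\check I'}\,\pi_c(\phi(z))$; (iii) in $\Gamma$, $X_{-i}(z)=X_{-i}(\phi(z))$; (iv) in $\Gamma$, if $X_i(z[\check I],z)=(J_1,a_1),\dots,(J_m,a_m)$,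 then $X_i(\phi(z)[\check I'],\phi(z))=(\psi(J_1),\omega_{J_1}(a_1)),\dots,(\psi(J_m),\omega_{J_m}(a_m))$. For a behavioral strategy profile $\sigma$ (a strategy of $j$ gives a distribution on $A(h)$ for each $h\in H_j$, constant on the information sets of $j$), let $\pi^\sigma(h,h')$ be the product of the probabilities of all choices made from $h$ to $h'$, $\pi^\sigma(z)=\pi^\sigma(\varnothing,z)$, $\pi^\sigma_{-i}(h)$ the product of the probabilities of all choices on the way to $h$ that are not made by $i$, $u_i(\sigma)=\sum_{z\in Z}u_i(z)\pi^\sigma(z)$, and $v_i(\sigma,I)=\sum_{z\in Z_I}u_i(z)\pi^\sigma_{-i}(z[I])\pi^\sigma(z[I],z)$. For profiles $\sigma^1,\sigma^2,\dots$ of $\Gamma$ let $R_i^T(I,a)=\sum_{t=1}^T\bigl(v_i(\sigma^t_{I\to a},I)-v_i(\sigma^t,I)\bigr)$, where $\sigma_{I\to a}$ is $\sigma$ except that $i$ always takes $a$ at $I$. Player $i$ follows CFR in $\Gamma$ if for all $T\ge 0$, $I\in\mathcal I_i$, $a\in A(I)$, $$\sigma^{T+1}_i(I,a)=\frac{\max\{R_i^T(I,a),0\}}{\sum_{b\in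 A(I)}\max\{R_i^T(I,b),0\}},$$ read as $1/|A(I)|$ if the denominator is $0$. Theorem. Let $\Gamma$ be nearly well-formed with respect to $\check\Gamma$ with constants $k,\ell$, and let $\sigma^1,\sigma^2,\dots$ be strategy profiles of $\Gamma$ in which player $i$ follows CFR in $\Gamma$. Then, for every $T\ge 1$, the regret $\check R_i^T=\max_{\sigma'}\sum_{t=1}^T\bigl(u_i(\sigma',\sigma^t_{-i})-u_i(\sigma^t)\bigr)$, the maximum being over all strategies $\sigma'$ of player $i$ in $\check\Gamma$, satisfies $$\frac{\check R_i^T}{T}\le\frac{\Delta_i K\sqrt{|A_i|}}{\sqrt T},$$ where $\Delta_i=\max_{z,z'\in Z}(u_i(z)-u_i(z'))$, $|A_i|=\max_{I\in\mathcal I_i}|A(I)|$ and $K=\sum_{I\in\mathcal I_i}\max_{\check I,\check I'\in\check{\mathcal P}(I)}k_{\check I,\check I'}\ell_{\check I,\check I'}$. -/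

import Mathlib

open scoped NNReal

noncomputable section

namespace ExtensiveForm

/-- A finite extensive-form game without its information partitions: a finite prefix-closed set of
histories (finite sequences of actions), the player function (`none` is chance), chance's fixed
probabilities, and the utilities at terminal histories.  The values of `turn` at terminal
histories, and of all functions at sequences that are not histories, are irrelevant. -/
structure GameTree (N α : Type*) [Fintype α] [DecidableEq α] where
  hist : Finset (List α)
  nil_mem : [] ∈ hist
  prefix_mem : ∀ (h : List α) (a : α), h ++ [a] ∈ hist → h ∈ hist
  turn : List α → Option N
  chance : List α → α → ℝ
  util : N → List α → ℝ
  chance_nonneg : ∀ (h : List α) (a : α), turn h = none → h ++ [a] ∈ hist → 0 ≤ chance h a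
  chance_sum : ∀ h : List α, turn h = none → (∃ a, h ++ [a] ∈ hist) →
    ∑ a with h ++ [a] ∈ hist, chance h a = 1

/-- The list of pairs `(h', a)` with `h'a ⊑ h`, in the order in which they occur in `h`. -/
def moves {α : Type*} (h : List α) : List (List α × α) := h.inits.zip h

/-- The list of pairs `(g, a)` with `h ⊑ g` and `ga ⊑ h'`; it is empty if `h` is not a prefix of
`h'`. -/
def movesFrom {α : Type*} [DecidableEq α] (h h' : List α) : List (List α × α) :=
  (moves h').filter fun m => h <+: m.1

/-- `z[S]`, the shortest prefix of `z` that lies in `S`.  If `S` is an information set that `z`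
passes through, this is the only prefix of `z` in `S` (the value `[]` if there is none is
irrelevant). -/
def prefixIn {α : Type*} [DecidableEq α] (S : Finset (List α)) (z : List α) : List α :=
  (z.inits.find? fun h => h ∈ S).getD []

/-- A behavior of one player: the probability of each action at each history. -/
abbrev Behavior (α : Type*) := List α → α → ℝ

namespace GameTree

variable {N α : Type*} [DecidableEq N] [Fintype α] [DecidableEq α] (G : GameTree N α)

/-- `A(h)`, the actions available at `h`. -/
def actions (h : List α) : Finset α := {a | h ++ [a] ∈ G.hist}

/-- `Z`, the terminal histories. -/
def terminals : Finset (List α) := {z ∈ G.hist | ∀ h ∈ G.hist, z <+: h → h = z}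

/-- `H_i`, the (non-terminal) histories at which player `i` acts. -/
def playerHist (i : N) : Finset (List α) := {h ∈ G.hist | h ∉ G.terminals ∧ G.turn h = some i}

/-- `A(I)`, the common set of actions at the histories of an information set `I`. -/
def actionsAt (I : Finset (List α)) : Finset α := I.biUnion G.actions

/-- `Z_S`, the terminal histories with a prefix in `S`. -/
def terminalsThrough (S : Finset (List α)) : Finset (List α) :=
  {z ∈ G.terminals | ∃ h ∈ S, h <+: z}

/-- The probability with which whoever acts at `h` (a player, or chance) chooses `a` there. -/
def moveProb (σ : N → Behavior α) (m : List α × α) : ℝ :=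
  match G.turn m.1 with
  | none => G.chance m.1 m.2
  | some j => σ j m.1 m.2

/-- `π^σ(h, h')`; `π^σ(h)` is the case where the first argument is the empty history. -/
def reach (σ : N → Behavior α) (h h' : List α) : ℝ :=
  ((movesFrom h h').map (G.moveProb σ)).prod

/-- `π_{-i}^σ(h)`: the contribution of all players except `i`, and of chance. -/
def reachOthers (i : N) (σ : N → Behavior α) (h : List α) : ℝ :=
  (((moves h).filter fun m => G.turn m.1 ≠ some i).map (G.moveProb σ)).prod

/-- `π_c(h)`: the contribution of chance. -/
def reachChance (h : List α) : ℝ :=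
  (((moves h).filter fun m => G.turn m.1 = none).map fun m => G.chance m.1 m.2).prod

/-- `u_i(σ)`, the expected utility of player `i`. -/
def expectedUtil (i : N) (σ : N → Behavior α) : ℝ :=
  ∑ z ∈ G.terminals, G.util i z * G.reach σ [] z

/-- `Δ_i`, the maximum of `u_i(z) - u_i(z')` over terminal `z, z'`. -/
def utilRange (i : N) : ℝ :=
  sSup {x | ∃ z ∈ G.terminals, ∃ z' ∈ G.terminals, x = G.util i z - G.util i z'}

/-- The counterfactual value `v_i(σ, I)`. -/
def cfValue (i : N) (σ : N → Behavior α) (I : Finset (List α)) : ℝ :=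
  ∑ z ∈ G.terminalsThrough I,
    G.util i z * G.reachOthers i σ (prefixIn I z) * G.reach σ (prefixIn I z) z

end GameTree

/-- `σ_{I → a}`: the profile `σ`, except that player `i` always takes `a` at `I`. -/
def forceAction {N α : Type*} [DecidableEq N] [DecidableEq α]
    (i : N) (I : Finset (List α)) (a : α) (σ : N → Behavior α) : N → Behavior α :=
  Function.update σ i fun h b => if h ∈ I then (if b = a then 1 else 0) else σ i h b

namespace GameTree

variable {N α : Type*} [DecidableEq N] [Fintype α] [DecidableEq α] (G : GameTree N α)

/-- The immediate counterfactual regret `R_i^T(I, a) = ∑_{t = 1}^T r_i^t(I, a)`, where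
`r_i^t(I, a) = v_i(σ^t_{I → a}, I) - v_i(σ^t, I)`. -/
def cfRegret (i : N) (σ : ℕ → N → Behavior α) (T : ℕ) (I : Finset (List α)) (a : α) : ℝ :=
  ∑ t ∈ Finset.Icc 1 T, (G.cfValue i (forceAction i I a (σ t)) I - G.cfValue i (σ t) I)

end GameTree

/-- Information partitions for a game tree.  A `GameTree` together with an `Info` is an
extensive-form game.  No play meets the same information set twice. -/
structure Info {N α : Type*} [DecidableEq N] [Fintype α] [DecidableEq α] (G : GameTree N α) where
  part : (i : N) → Finpartition (G.playerHist i)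
  actions_eq : ∀ i, ∀ I ∈ (part i).parts, ∀ h ∈ I, ∀ h' ∈ I, G.actions h = G.actions h'
  no_repeat : ∀ i, ∀ I ∈ (part i).parts, ∀ h ∈ I, ∀ h' ∈ I, h <+: h' → h = h'

namespace Info

variable {N α : Type*} [DecidableEq N] [Fintype α] [DecidableEq α] {G : GameTree N α}
  (Γ : Info G)

/-- `𝓘_i`, the information sets of player `i`. -/
def sets (i : N) : Finset (Finset (List α)) := (Γ.part i).parts

/-- `I(h)`, the information set containing `h` (empty if no player acts at `h`). -/
def infoSet (h : List α) : Finset (List α) :=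
  match G.turn h with
  | none => ∅
  | some j => (Γ.part j).part h

/-- `X_i(h, h')`, the sequence of information set, action pairs of player `i` from `h` to `h'`;
`X_i(h)` is the case where the first argument is the empty history. -/
def seq (i : N) (h h' : List α) : List (Finset (List α) × α) :=
  ((movesFrom h h').filter fun m => G.turn m.1 = some i).map fun m => (Γ.infoSet m.1, m.2)

/-- `X_{-i}(h)`, the sequence of information set, action pairs of the players other than `i`. -/
def seqOthers (i : N) (h : List α) : List (Finset (List α) × α) :=
  ((moves h).filter fun m => G.turn m.1 ≠ some i ∧ G.turn m.1 ≠ none).map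
    fun m => (Γ.infoSet m.1, m.2)

def PerfectRecall : Prop :=
  ∀ i, ∀ I ∈ Γ.sets i, ∀ h ∈ I, ∀ h' ∈ I, Γ.seq i [] h = Γ.seq i [] h'

/-- `Γ'` is a perfect recall refinement of `Γ`. -/
def IsPerfectRecallRefinement (Γ' : Info G) : Prop :=
  Γ'.PerfectRecall ∧ ∀ i, ∀ h ∈ G.playerHist i, ∀ h' ∈ G.playerHist i,
    Γ'.infoSet h = Γ'.infoSet h' → Γ.infoSet h = Γ.infoSet h'

/-- The information sets of player `i` in the refinement `Γ'` that are subsets of `I`. -/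
def refinedSets (Γ' : Info G) (i : N) (I : Finset (List α)) : Finset (Finset (List α)) :=
  {J ∈ Γ'.sets i | J ⊆ I}

/-- `D_i(S)`, the information sets of player `i` descending from a history in `S`. -/
def descendants (i : N) (S : Finset (List α)) : Finset (Finset (List α)) :=
  {I ∈ Γ.sets i | ∃ h ∈ S, ∃ h' ∈ I, h <+: h'}

/-- `Γ` is nearly well-formed with respect to its refinement `Γ'`, with constants
`k J J'` and `l J J'`.  The information sequences in the last two conditions are those of `Γ`. -/
def NearlyWellFormed (Γ' : Info G) (k l : Finset (List α) → Finset (List α) → ℝ≥0) : Prop :=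
  Γ.IsPerfectRecallRefinement Γ' ∧
  ∀ i, ∀ I ∈ Γ.sets i, ∀ S ∈ refinedSets Γ' i I, ∀ S' ∈ refinedSets Γ' i I,
    ∃ (φ : List α → List α) (ψ : Finset (List α) → Finset (List α))
      (ω : Finset (List α) → α → α),
      Set.BijOn φ (G.terminalsThrough S) (G.terminalsThrough S') ∧
      Set.BijOn ψ (Γ.descendants i S) (Γ.descendants i S') ∧
      (∀ J ∈ Γ.descendants i S, Set.BijOn (ω J) (G.actionsAt J) (G.actionsAt (ψ J))) ∧
      (∀ a ∈ G.actionsAt I, ω I a = a) ∧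
      ∀ z ∈ G.terminalsThrough S,
        G.util i z = k S S' * G.util i (φ z) ∧
        G.reachChance z = l S S' * G.reachChance (φ z) ∧
        Γ.seqOthers i z = Γ.seqOthers i (φ z) ∧
        Γ.seq i (prefixIn S' (φ z)) (φ z) =
          (Γ.seq i (prefixIn S z) z).map fun p => (ψ p.1, ω p.1 p.2)

/-- `s` is a behavioral strategy of player `i`: an element of `Σ_i`. -/
structure IsStrategy (i : N) (s : Behavior α) : Prop where
  nonneg : ∀ h ∈ G.playerHist i, ∀ a ∈ G.actions h, 0 ≤ s h a
  sum_eq_one : ∀ h ∈ G.playerHist i, ∑ a ∈ G.actions h, s h a = 1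
  const : ∀ I ∈ Γ.sets i, ∀ h ∈ I, ∀ h' ∈ I, ∀ a ∈ G.actionsAt I, s h a = s h' a

/-- `σ` is a strategy profile: an element of `Σ`. -/
def IsProfile (σ : N → Behavior α) : Prop := ∀ i, Γ.IsStrategy i (σ i)

/-- The utility gained by player `i` by playing `s` in place of `σ^t_i` at `t = 1, …, T`. -/
def gain (i : N) (σ : ℕ → N → Behavior α) (T : ℕ) (s : Behavior α) : ℝ :=
  ∑ t ∈ Finset.Icc 1 T,
    (G.expectedUtil i (Function.update (σ t) i s) - G.expectedUtil i (σ t))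

/-- The external regret `R_i^T`, the best gain over all strategies of player `i` in `Γ`. -/
def regret (i : N) (σ : ℕ → N → Behavior α) (T : ℕ) : ℝ :=
  sSup {x | ∃ s, Γ.IsStrategy i s ∧ x = gain (G := G) i σ T s}

theorem append_mem_of_mem_moves {N α : Type*} [Fintype α] [DecidableEq α] {G : GameTree N α}
    {h g : List α} {a : α} (hh : h ∈ G.hist)
    (hm : (g, a) ∈ moves h) : g ++ [a] ∈ G.hist := by
  have hpre : ∀ (t s : List α), s ++ t ∈ G.hist → s ∈ G.hist := by
    intro t
    induction t using List.reverseRecOn with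
    | nil => intro s hs; simpa using hs
    | append_singleton t b ih =>
      intro s hs
      exact ih s (G.prefix_mem _ b (by simpa using hs))
  rw [moves, List.mem_iff_getElem] at hm
  obtain ⟨n, hn, he⟩ := hm
  simp only [List.getElem_zip, List.getElem_inits, Prod.mk.injEq] at he
  have hn' : n < h.length := by simp at hn; omega
  obtain ⟨rfl, rfl⟩ := he
  apply hpre (h.drop (n + 1))
  simpa using hh

theorem moveProb_mem (Γ : Info G) {Γ' : Info G} {σ : N → Behavior α} {i : N} {s : Behavior α}
    (hσ : Γ.IsProfile σ) (hs : Γ'.IsStrategy i s) {h g : List α} {a : α} (hh : h ∈ G.hist)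
    (hm : (g, a) ∈ moves h) :
    0 ≤ G.moveProb (Function.update σ i s) (g, a) ∧
      G.moveProb (Function.update σ i s) (g, a) ≤ 1 := by
  have hga := append_mem_of_mem_moves hh hm
  have ha : a ∈ G.actions g := by simpa [GameTree.actions] using hga
  have key : ∀ (Γ₀ : Info G) (j : N) (r : Behavior α), Γ₀.IsStrategy j r →
      G.turn g = some j → 0 ≤ r g a ∧ r g a ≤ 1 := by
    intro Γ₀ j r hr hj
    have hg : g ∈ G.playerHist j := by
      simp only [GameTree.playerHist, GameTree.terminals, Finset.mem_filter, hj]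
      refine ⟨G.prefix_mem g a hga, fun hc => ?_, trivial⟩
      simpa using hc.2 _ hga (List.prefix_append g [a])
    refine ⟨hr.nonneg g hg a ha, ?_⟩
    rw [← hr.sum_eq_one g hg]
    exact Finset.single_le_sum (f := r g) (hr.nonneg g hg) ha
  unfold GameTree.moveProb
  cases ht : G.turn g with
  | none =>
    refine ⟨G.chance_nonneg g a ht hga, ?_⟩
    rw [← G.chance_sum g ht ⟨a, hga⟩]
    exact Finset.single_le_sum (f := G.chance g)
      (fun b hb => G.chance_nonneg g b ht (by simpa using hb)) (by simpa using hga)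
  | some j =>
    by_cases hji : j = i
    · subst hji
      simpa using key Γ' j s hs ht
    · simpa [hji] using key Γ j (σ j) (hσ j) ht

/-- The gains are bounded, so that the supremum defining the regret is a genuine one. -/
theorem bddAbove_gain (Γ' : Info G) (i : N) (σ : ℕ → N → Behavior α)
    (hσ : ∀ t, 1 ≤ t → Γ.IsProfile (σ t)) (T : ℕ) :
    BddAbove {x | ∃ s, Γ'.IsStrategy i s ∧ x = gain (G := G) i σ T s} := by
  refine ⟨∑ t ∈ Finset.Icc 1 T,
    ((∑ z ∈ G.terminals, |G.util i z|) - G.expectedUtil i (σ t)), ?_⟩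
  rintro x ⟨s, hs, rfl⟩
  refine Finset.sum_le_sum fun t ht => sub_le_sub_right (Finset.sum_le_sum fun z hz => ?_) _
  have hzH : z ∈ G.hist := (Finset.mem_filter.1 hz).1
  have hl : ∀ L : List (List α × α), (∀ m ∈ L, m ∈ moves z) →
      0 ≤ (L.map (G.moveProb (Function.update (σ t) i s))).prod ∧
        (L.map (G.moveProb (Function.update (σ t) i s))).prod ≤ 1 := by
    intro L
    induction L with
    | nil => simp
    | cons m L ih =>
      intro hL
      obtain ⟨h1, h2⟩ := ih fun m hm => hL m (by simp [hm])
      obtain ⟨h3, h4⟩ := moveProb_mem Γ (hσ t (Finset.mem_Icc.1 ht).1) hs hzH (hL m (by simp))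
      rw [List.map_cons, List.prod_cons]
      exact ⟨mul_nonneg h3 h1, mul_le_one₀ h4 h1 h2⟩
  obtain ⟨h1, h2⟩ := hl (movesFrom [] z) fun m hm => List.mem_of_mem_filter hm
  calc G.util i z * G.reach (Function.update (σ t) i s) [] z
      ≤ |G.util i z| * G.reach (Function.update (σ t) i s) [] z :=
        mul_le_mul_of_nonneg_right (le_abs_self _) h1
    _ ≤ |G.util i z| := mul_le_of_le_one_right (abs_nonneg _) h2

/-- `|A_i|`, the largest number of actions at an information set of player `i`. -/
def maxActions (i : N) : ℕ := (Γ.sets i).sup fun I => (G.actionsAt I).card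

/-- Player `i` follows CFR in `Γ`: at every `t = T + 1 ≥ 1` her strategy is obtained by regret
matching from the immediate counterfactual regrets of the first `T` profiles, uniformly at random
when no action has positive regret. -/
def FollowsCFR (i : N) (σ : ℕ → N → Behavior α) : Prop :=
  ∀ T : ℕ, ∀ I ∈ Γ.sets i, ∀ h ∈ I, ∀ a ∈ G.actionsAt I,
    σ (T + 1) i h a =
      if 0 < ∑ b ∈ G.actionsAt I, max (G.cfRegret i σ T I b) 0 then
        max (G.cfRegret i σ T I a) 0 / ∑ b ∈ G.actionsAt I, max (G.cfRegret i σ T I b) 0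
      else 1 / ((G.actionsAt I).card : ℝ)

/-- `K`, the sum over `I ∈ 𝓘_i` of the maximum of `k J J' * l J J'` over the pairs `J, J'` of
information sets of the refinement contained in `I`. -/
def mergeConst (Γ' : Info G) (i : N) (k l : Finset (List α) → Finset (List α) → ℝ≥0) : ℝ≥0 :=
  ∑ I ∈ Γ.sets i,
    (refinedSets Γ' i I ×ˢ refinedSets Γ' i I).sup fun p => k p.1 p.2 * l p.1 p.2

end Info

end ExtensiveForm

end

/-! Let V(h) (`histValue`) be the sum, over terminal z extending h, of u_i(z) times the others'
contribution to all of z times player i's own contribution from h to z. Telescoping own reach under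
s times V over the tree writes the gain of a deviation s as the sum over h in H_i of π_i^s(h) (Σ_a
s(h,a) V(ha) − V(h)), with V computed from the current profile; no recall is needed for this
(`expectedUtil_update_sub`). The CFR regret of a at I is the sum over rounds and over h in I of
V(ha) − V(h), unweighted. The two differ because s weights the refined sets inside I by its own
reach and may act differently on each of them.

Neither matters if the cumulative advantage vectors of the refined sets in I are nonnegative
multiples of one another: one action is then best on all of them, and reweighting only rescales the
vector. A matching φ, ψ, ω gives this proportionality, with factor kl, as soon as σ_i plays alike at
J and ψ(J) for all descendants J (`sum_below_advantage`). That is not a hypothesis but a property of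
CFR, proved by induction on the round (`FollowsCFR.respectsMatchings`). If it holds in all earlier
rounds, the advantages on the part of J below S are kl times those on the part of ψ(J) below S'. By
perfect recall of the refinement these parts are unions of refined sets, so the full regrets at J
and ψ(J) are positive multiples of them (`exists_pos_cumAdvantage_eq`), and regret matching ignores
positive factors.

Finally, fix s and I. Blackwell's argument applies directly to the reach-weighted vectors Σ_{h∈I}
π_i^s(h) (V(ha) − V(h)). They are bounded by Δ_i, being differences of two expected utilities, and
CFR is regret matching for them too, by proportionality. So I contributes at most Δ_i √(|A(I)| T),
without any constant (`FollowsCFR.sum_gain_le`). The constant K enters only at the end: either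
utility times chance vanishes throughout I and I contributes nothing, or matching a refined set with
itself forces kl = 1, so that the maximum in K is at least 1. -/

noncomputable section

namespace ExtensiveForm

/-! ### Moves along a play -/

section Paths

variable {α : Type*}

/-- The moves made along the actions `t`, starting from the history `h`. -/
def path : List α → List α → List (List α × α)
  | _, [] => []
  | h, a :: t => (h, a) :: path (h ++ [a]) t

theorem zip_inits_eq_path (h l : List α) : (l.inits.map (h ++ ·)).zip l = path h l := by
  induction l generalizing h with
  | nil => simp [path]
  | cons a l ih =>
    simp only [List.inits_cons, List.map_cons, List.zip_cons_cons, path, List.append_nil,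
      List.map_map]
    rw [← ih (h ++ [a])]
    simp [Function.comp_def]

theorem moves_eq_path (h : List α) : moves h = path [] h := by
  rw [← zip_inits_eq_path]; simp [moves]

theorem path_append (h s t : List α) : path h (s ++ t) = path h s ++ path (h ++ s) t := by
  induction s generalizing h with
  | nil => simp [path]
  | cons a s ih => simp [path, ih]

theorem mem_path {h t : List α} {m : List α × α} :
    m ∈ path h t ↔ h <+: m.1 ∧ m.1 ++ [m.2] <+: h ++ t := by
  induction t generalizing h with
  | nil =>
    simp only [path, List.not_mem_nil, List.append_nil, false_iff, not_and]
    intro h1 h2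
    have := h1.length_le
    have := h2.length_le
    simp at this
    omega
  | cons a t ih =>
    obtain ⟨g, b⟩ := m
    simp only [path, List.mem_cons, ih, Prod.mk.injEq]
    have e : h ++ [a] ++ t = h ++ a :: t := by simp
    rw [e]
    constructor
    · rintro (⟨rfl, rfl⟩ | ⟨h1, h2⟩)
      · exact ⟨List.prefix_rfl, ⟨t, by simp⟩⟩
      · exact ⟨(List.prefix_append _ _).trans h1, h2⟩
    · rintro ⟨⟨r, rfl⟩, ⟨q, h2⟩⟩
      cases r with
      | nil => simp at h2; left; simp [h2.1]
      | cons c r =>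
        simp at h2
        obtain ⟨rfl, rfl⟩ := h2
        right
        exact ⟨⟨r, by simp⟩, ⟨q, by simp⟩⟩

theorem moves_concat (h : List α) (a : α) : moves (h ++ [a]) = moves h ++ [(h, a)] := by
  simp [moves_eq_path, path_append, path]

theorem mem_moves {h : List α} {m : List α × α} : m ∈ moves h ↔ m.1 ++ [m.2] <+: h := by
  simp [moves_eq_path, mem_path]

variable [DecidableEq α]

theorem movesFrom_append (h t : List α) : movesFrom h (h ++ t) = path h t := by
  have h1 : (path [] h).filter (fun m => decide (h <+: m.1)) = [] := by
    rw [List.filter_eq_nil_iff]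
    intro m hm
    rw [mem_path] at hm
    have := hm.2.length_le
    simp only [decide_eq_true_eq]
    intro h2
    have := h2.length_le
    simp at *
    omega
  rw [movesFrom, moves_eq_path, path_append, List.filter_append, h1, List.nil_append,
    List.nil_append, List.filter_eq_self]
  intro m hm
  simpa using (mem_path.1 hm).1

theorem movesFrom_nil (z : List α) : movesFrom [] z = moves z := by
  rw [moves_eq_path]; exact movesFrom_append [] z

theorem movesFrom_self (z : List α) : movesFrom z z = [] := by
  simpa [path] using movesFrom_append z []

theorem movesFrom_of_prefix {h z : List α} {a : α} (hz : h ++ [a] <+: z) :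
    movesFrom h z = (h, a) :: movesFrom (h ++ [a]) z := by
  obtain ⟨t, rfl⟩ := hz
  rw [movesFrom_append]
  rw [List.append_assoc, movesFrom_append]
  simp [path]

theorem mem_movesFrom {h z : List α} {m : List α × α} :
    m ∈ movesFrom h z ↔ h <+: m.1 ∧ m.1 ++ [m.2] <+: z := by
  rw [movesFrom, List.mem_filter, mem_moves]
  simp [and_comm]

theorem prefixIn_eq {S : Finset (List α)} {z h : List α} (hh : h ∈ S) (hz : h <+: z)
    (hu : ∀ g ∈ S, g <+: z → g = h) : prefixIn S z = h := by
  rw [prefixIn]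
  cases hf : z.inits.find? (fun h => decide (h ∈ S)) with
  | none =>
    rw [List.find?_eq_none] at hf
    exact absurd hh (by simpa using hf h (by simpa using hz))
  | some g =>
    have h1 := List.find?_some hf
    have h2 := List.mem_of_find?_eq_some hf
    simpa using hu g (by simpa using h1) (by simpa using h2)

end Paths

theorem prod_map_filter_mul {β : Type*} (L : List β) (p : β → Bool) (f : β → ℝ) :
    ((L.filter p).map f).prod * ((L.filter fun x => !p x).map f).prod = (L.map f).prod := by
  induction L with
  | nil => simp
  | cons x L ih =>
    cases hp : p x <;> simp [hp, ← ih] <;> ring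

/-! ### Values of single histories and the decomposition of the gain -/

namespace GameTree

variable {N α : Type*} [DecidableEq N] [Fintype α] [DecidableEq α] (G : GameTree N α)

variable {G} in
theorem hist_of_prefix {h z : List α} (hz : z ∈ G.hist) (hp : h <+: z) : h ∈ G.hist := by
  obtain ⟨t, rfl⟩ := hp
  induction t using List.reverseRecOn with
  | nil => simpa using hz
  | append_singleton t b ih => exact ih (G.prefix_mem _ b (by simpa using hz))

variable {G} in
theorem mem_actions {h : List α} {a : α} : a ∈ G.actions h ↔ h ++ [a] ∈ G.hist := by
  simp [actions]

variable {G} in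
theorem mem_terminals {z : List α} : z ∈ G.terminals ↔ z ∈ G.hist ∧ G.actions z = ∅ := by
  rw [terminals, Finset.mem_filter]
  refine and_congr_right fun hz => ⟨fun h => ?_, fun h g hg hp => ?_⟩
  · rw [Finset.eq_empty_iff_forall_notMem]
    intro a ha
    have := h _ (mem_actions.1 ha) (List.prefix_append _ _)
    simp at this
  · obtain ⟨t, rfl⟩ := hp
    cases t with
    | nil => simp
    | cons a t =>
      have : a ∈ G.actions z := mem_actions.2 (hist_of_prefix hg ⟨t, by simp⟩)
      simp [h] at this

/-- The non-terminal histories. -/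
def decisions : Finset (List α) := {h ∈ G.hist | (G.actions h).Nonempty}

variable {G} in
theorem mem_decisions {h : List α} : h ∈ G.decisions ↔ h ∈ G.hist ∧ (G.actions h).Nonempty := by
  simp [decisions]

variable {G} in
theorem mem_playerHist {h : List α} {i : N} :
    h ∈ G.playerHist i ↔ h ∈ G.decisions ∧ G.turn h = some i := by
  rw [playerHist, Finset.mem_filter, mem_terminals, mem_decisions, Finset.nonempty_iff_ne_empty]
  tauto

variable {G} in
theorem mem_playerHist_of_concat {h : List α} {a : α} {i : N} (hh : h ++ [a] ∈ G.hist)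
    (hi : G.turn h = some i) : h ∈ G.playerHist i :=
  mem_playerHist.2 ⟨mem_decisions.2 ⟨G.prefix_mem _ _ hh, a, mem_actions.2 hh⟩, hi⟩

/-- Summation by parts over the tree. -/
theorem sum_terminals_sub_root (F : List α → ℝ) :
    ∑ z ∈ G.terminals, F z - F [] =
      ∑ h ∈ G.decisions, (∑ a ∈ G.actions h, F (h ++ [a]) - F h) := by
  have h1 : ∑ z ∈ G.terminals, F z + ∑ h ∈ G.decisions, F h = ∑ h ∈ G.hist, F h := by
    rw [← Finset.sum_filter_add_sum_filter_not G.hist (fun h => G.actions h = ∅)]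
    congr 1
    · refine Finset.sum_congr ?_ fun _ _ => rfl
      ext z; simp [mem_terminals]
    · refine Finset.sum_congr ?_ fun _ _ => rfl
      ext z; simp [mem_decisions, Finset.nonempty_iff_ne_empty]
  -- Every history except the root arises exactly once as a parent followed by an action.
  have h2 : ∑ h ∈ G.decisions, ∑ a ∈ G.actions h, F (h ++ [a]) = ∑ h ∈ G.hist.erase [], F h := by
    rw [Finset.sum_sigma']
    refine Finset.sum_bij (fun p _ => p.1 ++ [p.2]) ?_ ?_ ?_ ?_
    · rintro ⟨h, a⟩ hp
      simp only [Finset.mem_sigma, mem_actions] at hp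
      simp [hp.2]
    · rintro ⟨h, a⟩ _ ⟨h', a'⟩ _ he
      have := List.append_inj' he rfl
      simp at this
      simp [this.1, this.2]
    · intro b hb
      rw [Finset.mem_erase] at hb
      obtain ⟨hb, hb'⟩ := hb
      obtain ⟨h, a, rfl⟩ := List.eq_nil_or_concat b |>.resolve_left hb
      simp only [List.concat_eq_append] at hb' ⊢
      refine ⟨⟨h, a⟩, ?_, rfl⟩
      simp only [Finset.mem_sigma, mem_actions, mem_decisions]
      exact ⟨⟨G.prefix_mem _ _ hb', a, mem_actions.2 hb'⟩, hb'⟩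
    · simp
  have h3 := Finset.add_sum_erase G.hist F G.nil_mem
  rw [Finset.sum_sub_distrib, h2]
  linarith

theorem sum_terminals_eq_root {F : List α → ℝ}
    (hF : ∀ h ∈ G.decisions, ∑ a ∈ G.actions h, F (h ++ [a]) = F h) :
    ∑ z ∈ G.terminals, F z = F [] := by
  rw [← sub_eq_zero, sum_terminals_sub_root]
  exact Finset.sum_eq_zero fun h hh => sub_eq_zero.2 (hF h hh)

/-- `π_i(h, h')`: the contribution of player `i`, who behaves according to `s`. -/
def own (i : N) (s : Behavior α) (h z : List α) : ℝ :=
  (((movesFrom h z).filter fun m => G.turn m.1 = some i).map fun m => s m.1 m.2).prod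

theorem own_self (i : N) (s : Behavior α) (z : List α) : G.own i s z z = 1 := by
  simp [own, movesFrom_self]

theorem own_of_prefix (i : N) (s : Behavior α) {h z : List α} {a : α} (hz : h ++ [a] <+: z) :
    G.own i s h z = (if G.turn h = some i then s h a else 1) * G.own i s (h ++ [a]) z := by
  rw [own, movesFrom_of_prefix hz, own]
  by_cases hi : G.turn h = some i <;> simp [hi]

theorem own_root_concat (i : N) (s : Behavior α) (h : List α) (a : α) :
    G.own i s [] (h ++ [a]) = G.own i s [] h * if G.turn h = some i then s h a else 1 := by
  rw [own, own, movesFrom_nil, movesFrom_nil, moves_concat]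
  by_cases hi : G.turn h = some i <;> simp [List.filter_append, hi]

theorem own_congr {i : N} {s s' : Behavior α} {h z : List α}
    (hs : ∀ g a, h <+: g → g ++ [a] <+: z → G.turn g = some i → s g a = s' g a) :
    G.own i s h z = G.own i s' h z := by
  rw [own, own]
  congr 1
  refine List.map_congr_left fun m hm => ?_
  rw [List.mem_filter, mem_movesFrom] at hm
  exact hs _ _ hm.1.1 hm.1.2 (by simpa using hm.2)

theorem reachOthers_update (i : N) (σ : N → Behavior α) (s : Behavior α) (h : List α) :
    G.reachOthers i (Function.update σ i s) h = G.reachOthers i σ h := by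
  rw [reachOthers, reachOthers]
  congr 1
  refine List.map_congr_left fun m hm => ?_
  rw [List.mem_filter] at hm
  have hm := hm.2
  simp only [decide_eq_true_eq, ne_eq] at hm
  rw [moveProb, moveProb]
  cases ht : G.turn m.1 with
  | none => rfl
  | some j =>
    have : j ≠ i := by rintro rfl; exact hm ht
    simp [this]

theorem prod_moveProb_own (i : N) (σ : N → Behavior α) (L : List (List α × α)) :
    ((L.filter fun m => G.turn m.1 = some i).map (G.moveProb σ)).prod =
      ((L.filter fun m => G.turn m.1 = some i).map fun m => σ i m.1 m.2).prod := by
  congr 1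
  refine List.map_congr_left fun m hm => ?_
  rw [List.mem_filter] at hm
  have := hm.2
  simp only [decide_eq_true_eq] at this
  simp [moveProb, this]

theorem reach_eq (i : N) (σ : N → Behavior α) (h z : List α) :
    G.reach σ h z = G.own i (σ i) h z *
      (((movesFrom h z).filter fun m => G.turn m.1 ≠ some i).map (G.moveProb σ)).prod := by
  rw [reach, own, ← prod_map_filter_mul _ (fun m => decide (G.turn m.1 = some i)),
    prod_moveProb_own]
  simp

/-- Pushing the others' contribution to the end of the play leaves a weight that depends on the
intermediate history only through player i's own moves. -/
theorem reachOthers_mul_reach (i : N) (σ : N → Behavior α) {h z : List α} (hz : h <+: z) :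
    G.reachOthers i σ h * G.reach σ h z = G.reachOthers i σ z * G.own i (σ i) h z := by
  rw [reach_eq G i, mul_left_comm, mul_comm]
  congr 1
  obtain ⟨t, rfl⟩ := hz
  rw [reachOthers, reachOthers, movesFrom_append, moves_eq_path, moves_eq_path, path_append]
  simp [List.filter_append]

theorem expectedUtil_eq (i : N) (σ : N → Behavior α) :
    G.expectedUtil i σ =
      ∑ z ∈ G.terminals, G.util i z * G.reachOthers i σ z * G.own i (σ i) [] z := by
  refine Finset.sum_congr rfl fun z _ => ?_
  have := G.reachOthers_mul_reach i σ (List.nil_prefix (l := z))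
  rw [mul_assoc, ← this]
  simp [reachOthers, moves]

/-- The counterfactual value of a single history. -/
def histValue (i : N) (σ : N → Behavior α) (h : List α) : ℝ :=
  ∑ z ∈ G.terminals with h <+: z, G.util i z * G.reachOthers i σ z * G.own i (σ i) h z

theorem histValue_nil (i : N) (σ : N → Behavior α) :
    G.histValue i σ [] = G.expectedUtil i σ := by
  rw [histValue, expectedUtil_eq]
  simp

theorem histValue_terminal (i : N) (σ : N → Behavior α) {z : List α} (hz : z ∈ G.terminals) :
    G.histValue i σ z = G.util i z * G.reachOthers i σ z := by
  have : {z' ∈ G.terminals | z <+: z'} = {z} := by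
    ext z'
    simp only [Finset.mem_filter, Finset.mem_singleton]
    constructor
    · rintro ⟨h1, h2⟩
      exact (Finset.mem_filter.1 hz).2 z' (Finset.mem_filter.1 h1).1 h2
    · rintro rfl; exact ⟨hz, List.prefix_rfl⟩
  rw [histValue, this]
  simp [own_self]

theorem sum_terminals_of_decision {h : List α} (hh : h ∈ G.decisions) (F : List α → ℝ) :
    ∑ z ∈ G.terminals with h <+: z, F z =
      ∑ a ∈ G.actions h, ∑ z ∈ G.terminals with h ++ [a] <+: z, F z := by
  rw [← Finset.sum_biUnion]
  · refine Finset.sum_congr ?_ fun _ _ => rfl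
    ext z
    simp only [Finset.mem_filter, Finset.mem_biUnion, mem_actions]
    constructor
    · rintro ⟨hz, ⟨t, rfl⟩⟩
      cases t with
      | nil =>
        rw [mem_terminals] at hz
        rw [mem_decisions] at hh
        simp at hz hh
        simp [hz.2] at hh
      | cons a t =>
        have hp : h ++ [a] <+: h ++ a :: t := ⟨t, by simp⟩
        exact ⟨a, hist_of_prefix (mem_terminals.1 hz).1 hp, hz, hp⟩
    · rintro ⟨a, _, hz, hp⟩
      exact ⟨hz, (List.prefix_append _ _).trans hp⟩
  · intro a _ b _ hab
    rw [Function.onFun, Finset.disjoint_left]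
    intro z h1 h2
    rw [Finset.mem_filter] at h1 h2
    apply hab
    have := List.prefix_of_prefix_length_le h1.2 h2.2 (by simp)
    have := List.IsPrefix.eq_of_length this (by simp)
    simpa using this

theorem histValue_step (i : N) (σ : N → Behavior α) {h : List α} (hh : h ∈ G.decisions) :
    G.histValue i σ h = ∑ a ∈ G.actions h,
      (if G.turn h = some i then σ i h a else 1) * G.histValue i σ (h ++ [a]) := by
  rw [histValue, sum_terminals_of_decision _ hh]
  refine Finset.sum_congr rfl fun a _ => ?_
  rw [histValue, Finset.mul_sum]
  refine Finset.sum_congr rfl fun z hz => ?_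
  rw [own_of_prefix G i _ (Finset.mem_filter.1 hz).2]
  ring

theorem histValue_player (i : N) (σ : N → Behavior α) {h : List α} (hh : h ∈ G.playerHist i) :
    G.histValue i σ h = ∑ a ∈ G.actions h, σ i h a * G.histValue i σ (h ++ [a]) := by
  rw [mem_playerHist] at hh
  rw [histValue_step _ _ _ hh.1]
  simp [hh.2]

/-- The gain from deviating to `s`, decomposed over the histories of player `i`. -/
theorem expectedUtil_update_sub (i : N) (σ : N → Behavior α) (s : Behavior α) :
    G.expectedUtil i (Function.update σ i s) - G.expectedUtil i σ =
      ∑ h ∈ G.playerHist i, G.own i s [] h *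
        (∑ a ∈ G.actions h, s h a * G.histValue i σ (h ++ [a]) - G.histValue i σ h) := by
  have h1 : G.expectedUtil i (Function.update σ i s) =
      ∑ z ∈ G.terminals, G.own i s [] z * G.histValue i σ z := by
    rw [expectedUtil_eq]
    refine Finset.sum_congr rfl fun z hz => ?_
    rw [histValue_terminal _ _ _ hz, reachOthers_update, Function.update_self]
    ring
  have h2 : G.expectedUtil i σ = G.own i s [] [] * G.histValue i σ [] := by
    rw [own_self, histValue_nil, one_mul]
  -- The telescoped function is own reach under `s` times the value under `σ`: at the terminals it
  -- sums to the utility of the deviation, at the root it is the utility of `σ`. Where player i does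
  -- not act the increment vanishes, the others' probabilities being already inside `histValue`.
  rw [h1, h2, sum_terminals_sub_root G (fun h => G.own i s [] h * G.histValue i σ h)]
  have hsub : G.playerHist i ⊆ G.decisions := fun h hh => (mem_playerHist.1 hh).1
  rw [← Finset.sum_subset hsub]
  · refine Finset.sum_congr rfl fun h hh => ?_
    simp only [own_root_concat, (mem_playerHist.1 hh).2, if_true, mul_sub, Finset.mul_sum, mul_assoc]
  · intro h hh hn
    have : G.turn h ≠ some i := fun hi => hn (mem_playerHist.2 ⟨hh, hi⟩)
    rw [histValue_step G i σ hh]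
    simp [own_root_concat, this, Finset.mul_sum]

end GameTree

/-! ### Bounds by the utility range; counterfactual regret as a sum over histories -/

namespace GameTree

variable {N α : Type*} [DecidableEq N] [Fintype α] [DecidableEq α] (G : GameTree N α)

/-- `s` prescribes a distribution over the available actions at every history of player `i`. -/
def IsDistribution (i : N) (s : Behavior α) : Prop :=
  ∀ h ∈ G.playerHist i, (∀ a ∈ G.actions h, 0 ≤ s h a) ∧ ∑ a ∈ G.actions h, s h a = 1

theorem reach_root_concat (σ : N → Behavior α) (h : List α) (a : α) :
    G.reach σ [] (h ++ [a]) = G.reach σ [] h * G.moveProb σ (h, a) := by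
  rw [reach, reach, movesFrom_nil, movesFrom_nil, moves_concat]
  simp

variable {G}

theorem moveProb_nonneg {σ : N → Behavior α} (hσ : ∀ j, G.IsDistribution j (σ j)) {h : List α}
    {a : α} (ha : h ++ [a] ∈ G.hist) : 0 ≤ G.moveProb σ (h, a) := by
  unfold moveProb
  cases ht : G.turn h with
  | none => exact G.chance_nonneg h a ht ha
  | some j => exact (hσ j h (mem_playerHist_of_concat ha ht)).1 a (mem_actions.2 ha)

theorem sum_moveProb {σ : N → Behavior α} (hσ : ∀ j, G.IsDistribution j (σ j)) {h : List α}
    (hh : h ∈ G.decisions) : ∑ a ∈ G.actions h, G.moveProb σ (h, a) = 1 := by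
  unfold moveProb
  cases ht : G.turn h with
  | none =>
    obtain ⟨a, ha⟩ := (mem_decisions.1 hh).2
    simpa only [ht, actions] using G.chance_sum h ht ⟨a, mem_actions.1 ha⟩
  | some j => simpa only [ht] using (hσ j h (mem_playerHist.2 ⟨hh, ht⟩)).2

theorem reach_nonneg {σ : N → Behavior α} (hσ : ∀ j, G.IsDistribution j (σ j)) {h : List α}
    (hh : h ∈ G.hist) : 0 ≤ G.reach σ [] h := by
  induction h using List.reverseRecOn with
  | nil => simp [reach, movesFrom_self]
  | append_singleton h a ih =>
    rw [reach_root_concat]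
    exact mul_nonneg (ih (G.prefix_mem _ _ hh)) (moveProb_nonneg hσ hh)

theorem sum_reach {σ : N → Behavior α} (hσ : ∀ j, G.IsDistribution j (σ j)) :
    ∑ z ∈ G.terminals, G.reach σ [] z = 1 := by
  rw [sum_terminals_eq_root (F := fun z => G.reach σ [] z)]
  · simp [reach, movesFrom_self]
  · intro h hh
    simp only [reach_root_concat]
    rw [← Finset.mul_sum, sum_moveProb hσ hh, mul_one]

theorem util_sub_le_utilRange (i : N) {z z' : List α} (hz : z ∈ G.terminals)
    (hz' : z' ∈ G.terminals) : G.util i z - G.util i z' ≤ G.utilRange i := by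
  refine le_csSup (Set.Finite.bddAbove ?_) ⟨z, hz, z', hz', rfl⟩
  refine ((G.terminals ×ˢ G.terminals).image
    fun p => G.util i p.1 - G.util i p.2).finite_toSet.subset ?_
  rintro x ⟨z, hz, z', hz', rfl⟩
  simp only [Finset.coe_image, Set.mem_image]
  exact ⟨(z, z'), by simp [hz, hz'], rfl⟩

theorem expectedUtil_sub_le {i : N} {σ τ : N → Behavior α} (hσ : ∀ j, G.IsDistribution j (σ j))
    (hτ : ∀ j, G.IsDistribution j (τ j)) :
    G.expectedUtil i σ - G.expectedUtil i τ ≤ G.utilRange i := by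
  have hne : G.terminals.Nonempty := by
    by_contra hn
    rw [Finset.not_nonempty_iff_eq_empty] at hn
    simpa [hn] using sum_reach hσ
  obtain ⟨x, hx, hx'⟩ := Finset.exists_max_image G.terminals (G.util i) hne
  obtain ⟨y, hy, hy'⟩ := Finset.exists_min_image G.terminals (G.util i) hne
  have h1 : G.expectedUtil i σ ≤ G.util i x := by
    rw [expectedUtil, ← mul_one (G.util i x), ← sum_reach hσ, Finset.mul_sum]
    exact Finset.sum_le_sum fun z hz =>
      mul_le_mul_of_nonneg_right (hx' z hz) (reach_nonneg hσ (mem_terminals.1 hz).1)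
  have h2 : G.util i y ≤ G.expectedUtil i τ := by
    rw [expectedUtil, ← mul_one (G.util i y), ← sum_reach hτ, Finset.mul_sum]
    exact Finset.sum_le_sum fun z hz =>
      mul_le_mul_of_nonneg_right (hy' z hz) (reach_nonneg hτ (mem_terminals.1 hz).1)
  linarith [util_sub_le_utilRange i hx hy]

theorem utilRange_nonneg (i : N) : 0 ≤ G.utilRange i := by
  by_cases hne : G.terminals.Nonempty
  · obtain ⟨z, hz⟩ := hne
    simpa using util_sub_le_utilRange i hz hz
  · rw [Finset.not_nonempty_iff_eq_empty] at hne
    simp [utilRange, hne]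

theorem IsDistribution.update {i : N} {σ : N → Behavior α} {s : Behavior α}
    (hσ : ∀ j, G.IsDistribution j (σ j)) (hs : G.IsDistribution i s) (j : N) :
    G.IsDistribution j (Function.update σ i s j) := by
  by_cases h : j = i
  · subst h; simpa using hs
  · simpa [h] using hσ j

theorem IsDistribution.own_nonneg {i : N} {s : Behavior α} (hs : G.IsDistribution i s) {h : List α}
    (hh : h ∈ G.hist) : 0 ≤ G.own i s [] h := by
  induction h using List.reverseRecOn with
  | nil => simp [own_self]
  | append_singleton h a ih =>
    rw [own_root_concat]
    refine mul_nonneg (ih (G.prefix_mem _ _ hh)) ?_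
    split_ifs with ht
    · exact (hs h (mem_playerHist_of_concat hh ht)).1 a (mem_actions.2 hh)
    · exact zero_le_one

/-- Play `s` until `I` is reached, and `s'` from then on. -/
def switchAt (I : Finset (List α)) (s s' : Behavior α) : Behavior α :=
  fun h b => if ∃ g ∈ I, g <+: h then s' h b else s h b

theorem IsDistribution.switchAt {i : N} {s s' : Behavior α} (I : Finset (List α))
    (hs : G.IsDistribution i s) (hs' : G.IsDistribution i s') :
    G.IsDistribution i (switchAt I s s') := by
  intro h hh
  by_cases hI : ∃ g ∈ I, g <+: h
  · simpa [GameTree.switchAt, hI] using hs' h hh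
  · simpa [GameTree.switchAt, hI] using hs h hh

/-- Take `a` at `I`, and play `s` elsewhere. -/
def actAt (I : Finset (List α)) (a : α) (s : Behavior α) : Behavior α :=
  fun h b => if h ∈ I then (if b = a then 1 else 0) else s h b

theorem IsDistribution.actAt {i : N} {s : Behavior α} {I : Finset (List α)} {a : α}
    (hs : G.IsDistribution i s) (ha : ∀ h ∈ I, a ∈ G.actions h) :
    G.IsDistribution i (actAt I a s) := by
  intro h hh
  by_cases hI : h ∈ I
  · simp only [GameTree.actAt, hI, if_true]
    refine ⟨fun b _ => by split_ifs <;> norm_num, by simp [ha h hI]⟩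
  · simpa [GameTree.actAt, hI] using hs h hh

theorem own_switchAt {i : N} {I : Finset (List α)} (s s' : Behavior α) {h : List α}
    (hI : ∀ g ∈ I, g <+: h → g = h) : G.own i (switchAt I s s') [] h = G.own i s [] h := by
  refine G.own_congr fun g a _ hg _ => ?_
  rw [switchAt, if_neg]
  rintro ⟨f, hf, hfg⟩
  have := hI f hf (hfg.trans ((List.prefix_append _ _).trans hg))
  subst this
  have h1 := hfg.length_le
  have h2 := hg.length_le
  simp at h2
  omega

/-- The sum is a difference of two expected utilities: play `s` up to `I`, then either continue with
`σ i` or take `a` at `I` and continue with `σ i`. These hybrids need not be constant on information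
sets of any game, so only `IsDistribution` is asked of them. -/
theorem abs_sum_own_mul_histValue_le {i : N} {σ : N → Behavior α} {s : Behavior α}
    (hσ : ∀ j, G.IsDistribution j (σ j)) (hs : G.IsDistribution i s) {I : Finset (List α)}
    (hIi : I ⊆ G.playerHist i) (hI : ∀ h ∈ I, ∀ h' ∈ I, h <+: h' → h = h') {a : α}
    (ha : ∀ h ∈ I, a ∈ G.actions h) :
    |∑ h ∈ I, G.own i s [] h * (G.histValue i σ (h ++ [a]) - G.histValue i σ h)| ≤
      G.utilRange i := by
  set τ := switchAt I s (σ i)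
  set τ' := switchAt I s (actAt I a (σ i))
  have hτ : G.IsDistribution i τ := hs.switchAt I (hσ i)
  have hτ' : G.IsDistribution i τ' := hs.switchAt I ((hσ i).actAt ha)
  have key : G.expectedUtil i (Function.update σ i τ') - G.expectedUtil i (Function.update σ i τ) =
      ∑ h ∈ I, G.own i s [] h * (G.histValue i σ (h ++ [a]) - G.histValue i σ h) := by
    rw [← sub_sub_sub_cancel_right _ _ (G.expectedUtil i σ), expectedUtil_update_sub,
      expectedUtil_update_sub, ← Finset.sum_sub_distrib, ← Finset.sum_subset hIi]
    · refine Finset.sum_congr rfl fun h hh => ?_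
      have hex : ∃ g ∈ I, g <+: h := ⟨h, hh, List.prefix_rfl⟩
      have h1 : ∑ b ∈ G.actions h, τ' h b * G.histValue i σ (h ++ [b]) =
          G.histValue i σ (h ++ [a]) := by
        simp [τ', switchAt, hex, actAt, hh, ha h hh]
      have h2 : ∑ b ∈ G.actions h, τ h b * G.histValue i σ (h ++ [b]) = G.histValue i σ h := by
        rw [histValue_player G i σ (hIi hh)]
        simp [τ, switchAt, hex]
      rw [h1, h2, own_switchAt _ _ fun g hg hp => hI g hg h hh hp]
      ring
    -- Off `I` the terms cancel: strictly below `I` both hybrids agree with `σ i`, so both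
    -- increments vanish; elsewhere both agree with `s`.
    · intro h hh hn
      by_cases hex : ∃ g ∈ I, g <+: h
      · have h1 : ∑ b ∈ G.actions h, τ' h b * G.histValue i σ (h ++ [b]) = G.histValue i σ h := by
          rw [histValue_player G i σ hh]
          simp [τ', switchAt, hex, actAt, hn]
        have h2 : ∑ b ∈ G.actions h, τ h b * G.histValue i σ (h ++ [b]) = G.histValue i σ h := by
          rw [histValue_player G i σ hh]
          simp [τ, switchAt, hex]
        rw [h1, h2]
        ring
      · rw [own_switchAt _ _ fun g hg hp => absurd ⟨g, hg, hp⟩ hex,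
          own_switchAt _ _ fun g hg hp => absurd ⟨g, hg, hp⟩ hex]
        simp [τ, τ', switchAt, hex]
  have h1 := IsDistribution.update hσ hτ
  have h2 := IsDistribution.update hσ hτ'
  rw [← key, abs_le]
  constructor
  · linarith [expectedUtil_sub_le (i := i) h1 h2]
  · exact expectedUtil_sub_le h2 h1

/-- As `I` is an antichain for the prefix order, each terminal history is counted for exactly one of
its members. -/
theorem sum_terminalsThrough {I : Finset (List α)} (hI : ∀ h ∈ I, ∀ h' ∈ I, h <+: h' → h = h')
    (F : List α → List α → ℝ) :
    ∑ z ∈ G.terminalsThrough I, F (prefixIn I z) z =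
      ∑ h ∈ I, ∑ z ∈ G.terminals with h <+: z, F h z := by
  have hcmp : ∀ h ∈ I, ∀ h' ∈ I, ∀ z, h <+: z → h' <+: z → h = h' := by
    intro h hh h' hh' z hz hz'
    rcases List.prefix_or_prefix_of_prefix hz hz' with hp | hp
    · exact hI _ hh _ hh' hp
    · exact (hI _ hh' _ hh hp).symm
  have : G.terminalsThrough I = I.biUnion fun h => {z ∈ G.terminals | h <+: z} := by
    ext z
    simp only [terminalsThrough, Finset.mem_filter, Finset.mem_biUnion]
    tauto
  rw [this, Finset.sum_biUnion]
  · refine Finset.sum_congr rfl fun h hh => Finset.sum_congr rfl fun z hz => ?_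
    have hz := (Finset.mem_filter.1 hz).2
    rw [prefixIn_eq hh hz fun g hg hgz => hcmp g hg h hh z hgz hz]
  · intro h hh h' hh' hne
    rw [Function.onFun, Finset.disjoint_left]
    intro z h1 h2
    exact hne (hcmp h hh h' hh' z (Finset.mem_filter.1 h1).2 (Finset.mem_filter.1 h2).2)

theorem cfValue_eq (i : N) (σ : N → Behavior α) {I : Finset (List α)}
    (hI : ∀ h ∈ I, ∀ h' ∈ I, h <+: h' → h = h') :
    G.cfValue i σ I = ∑ h ∈ I, G.histValue i σ h := by
  rw [cfValue, sum_terminalsThrough hI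
    (fun h z => G.util i z * G.reachOthers i σ h * G.reach σ h z)]
  refine Finset.sum_congr rfl fun h hh => Finset.sum_congr rfl fun z hz => ?_
  rw [mul_assoc, reachOthers_mul_reach _ _ _ (Finset.mem_filter.1 hz).2, mul_assoc]

/-- After `h` the play never returns to `I`, so forcing `a` at `I` changes nothing but the move at
`h` itself. -/
theorem histValue_forceAction {i : N} (σ : N → Behavior α) {I : Finset (List α)}
    (hI : ∀ h ∈ I, ∀ h' ∈ I, h <+: h' → h = h') {h : List α} (hh : h ∈ I)
    (hhi : h ∈ G.playerHist i) {a : α} (ha : a ∈ G.actions h) :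
    G.histValue i (forceAction i I a σ) h = G.histValue i σ (h ++ [a]) := by
  rw [histValue_player _ _ _ hhi, Finset.sum_eq_single a]
  · simp only [forceAction, Function.update_self, hh, if_true, one_mul, histValue]
    refine Finset.sum_congr rfl fun z hz => ?_
    rw [reachOthers_update]
    congr 1
    refine G.own_congr fun g b hg _ _ => if_neg fun hgI => ?_
    have := hI h hh g hgI ((List.prefix_append _ _).trans hg)
    subst this
    simpa using hg.length_le
  · intro b _ hb
    simp [forceAction, hh, hb]
  · exact fun hn => absurd ha hn

theorem cfRegret_eq {i : N} (σ : ℕ → N → Behavior α) (T : ℕ) {I : Finset (List α)}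
    (hIi : I ⊆ G.playerHist i) (hI : ∀ h ∈ I, ∀ h' ∈ I, h <+: h' → h = h') {a : α}
    (ha : ∀ h ∈ I, a ∈ G.actions h) :
    G.cfRegret i σ T I a =
      ∑ t ∈ Finset.Icc 1 T, ∑ h ∈ I,
        (G.histValue i (σ t) (h ++ [a]) - G.histValue i (σ t) h) := by
  rw [cfRegret]
  refine Finset.sum_congr rfl fun t _ => ?_
  rw [cfValue_eq _ _ hI, cfValue_eq _ _ hI, ← Finset.sum_sub_distrib]
  exact Finset.sum_congr rfl fun h hh => by
    rw [histValue_forceAction _ hI hh (hIi hh) (ha h hh)]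

end GameTree

/-- Blackwell's bound for regret matching. -/
theorem regretMatching_bound {α : Type*} (A : Finset α) (y : ℕ → α → ℝ) {D : ℝ} (hD : 0 ≤ D)
    (T : ℕ) (hy : ∀ t ∈ Finset.Icc 1 T, ∀ a ∈ A, |y t a| ≤ D)
    (horth : ∀ t < T, ∑ a ∈ A, max (∑ s ∈ Finset.Icc 1 t, y s a) 0 * y (t + 1) a = 0)
    {a : α} (ha : a ∈ A) :
    ∑ t ∈ Finset.Icc 1 T, y t a ≤ D * √((A.card : ℝ) * T) := by
  -- The squared norm of the positive part grows by at most `A.card * D ^ 2` per round, since the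
  -- cross term is zero by `horth`.
  have key : ∀ t ≤ T, ∑ a ∈ A, max (∑ s ∈ Finset.Icc 1 t, y s a) 0 ^ 2 ≤ A.card * t * D ^ 2 := by
    intro t
    induction t with
    | zero => simp
    | succ t ih =>
      intro ht
      have hpt : ∀ b ∈ A, max (∑ s ∈ Finset.Icc 1 (t + 1), y s b) 0 ^ 2 ≤
          max (∑ s ∈ Finset.Icc 1 t, y s b) 0 ^ 2 +
            2 * (max (∑ s ∈ Finset.Icc 1 t, y s b) 0 * y (t + 1) b) + D ^ 2 := by
        intro b hb
        rw [Finset.sum_Icc_succ_top (by omega)]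
        set x := ∑ s ∈ Finset.Icc 1 t, y s b
        have h1 : y (t + 1) b ^ 2 ≤ D ^ 2 :=
          sq_le_sq' (abs_le.1 (hy _ (by simp; omega) b hb)).1
            (abs_le.1 (hy _ (by simp; omega) b hb)).2
        have h2 : max (x + y (t + 1) b) 0 ^ 2 ≤ (max x 0 + y (t + 1) b) ^ 2 := by
          rcases le_total (x + y (t + 1) b) 0 with h | h
          · simpa [max_eq_right h] using sq_nonneg _
          · rw [max_eq_left h]
            exact pow_le_pow_left₀ h (by gcongr; exact le_max_left _ _) 2
        nlinarith
      have := Finset.sum_le_sum hpt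
      rw [Finset.sum_add_distrib, Finset.sum_add_distrib, ← Finset.mul_sum,
        horth t (by omega)] at this
      have := ih (by omega)
      simp only [Finset.sum_const, nsmul_eq_mul] at *
      push_cast
      linarith
  have h1 := (Finset.single_le_sum (f := fun a => max (∑ s ∈ Finset.Icc 1 T, y s a) 0 ^ 2)
    (fun _ _ => sq_nonneg _) ha).trans (key T le_rfl)
  have h2 : D * √((A.card : ℝ) * T) = √(A.card * T * D ^ 2) := by
    rw [Real.sqrt_mul (by positivity) (D ^ 2), Real.sqrt_sq hD, mul_comm]
  rw [h2]
  exact (le_max_left _ 0).trans (Real.le_sqrt_of_sq_le h1)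

theorem GameTree.exists_terminal {N α : Type*} [DecidableEq N] [Fintype α] [DecidableEq α]
    {G : GameTree N α} {h : List α} (hh : h ∈ G.hist) : ∃ z ∈ G.terminals, h <+: z := by
  obtain ⟨z, hz, hmax⟩ := Finset.exists_max_image {z ∈ G.hist | h <+: z} List.length
    ⟨h, by simp [hh]⟩
  rw [Finset.mem_filter] at hz
  refine ⟨z, Finset.mem_filter.2 ⟨hz.1, fun g hg hp => ?_⟩, hz.2⟩
  have := hmax g (by simp [hg, hz.2.trans hp])
  exact (hp.eq_of_length_le this).symm

/-! ### Information sets and the factorization of reach probabilities -/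

namespace Info

open GameTree

variable {N α : Type*} [DecidableEq N] [Fintype α] [DecidableEq α] {G : GameTree N α}
  {Γ : Info G}

theorem subset_playerHist {i : N} {I : Finset (List α)} (hI : I ∈ Γ.sets i) :
    I ⊆ G.playerHist i := (Γ.part i).le hI

theorem nonempty_of_mem_sets {i : N} {I : Finset (List α)} (hI : I ∈ Γ.sets i) : I.Nonempty :=
  (Γ.part i).nonempty_of_mem_parts hI

theorem actionsAt_eq {i : N} {I : Finset (List α)} (hI : I ∈ Γ.sets i) {h : List α} (hh : h ∈ I) :
    G.actionsAt I = G.actions h := by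
  ext a
  simp only [actionsAt, Finset.mem_biUnion]
  constructor
  · rintro ⟨g, hg, ha⟩
    rwa [Γ.actions_eq i I hI h hh g hg]
  · exact fun ha => ⟨h, hh, ha⟩

theorem infoSet_eq_part {i : N} {h : List α} (hh : G.turn h = some i) :
    Γ.infoSet h = (Γ.part i).part h := by
  simp [infoSet, hh]

theorem infoSet_mem_sets {i : N} {h : List α} (hh : h ∈ G.playerHist i) :
    Γ.infoSet h ∈ Γ.sets i := by
  rw [infoSet_eq_part (mem_playerHist.1 hh).2]
  exact (Γ.part i).part_mem.2 hh

theorem mem_infoSet {i : N} {h : List α} (hh : h ∈ G.playerHist i) : h ∈ Γ.infoSet h := by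
  rw [infoSet_eq_part (mem_playerHist.1 hh).2]
  exact (Γ.part i).mem_part hh

theorem infoSet_eq {i : N} {I : Finset (List α)} (hI : I ∈ Γ.sets i) {h : List α} (hh : h ∈ I) :
    Γ.infoSet h = I := by
  rw [infoSet_eq_part (mem_playerHist.1 (subset_playerHist hI hh)).2]
  exact (Γ.part i).part_eq_of_mem hI hh

theorem eq_of_prefix {i : N} {I : Finset (List α)} (hI : I ∈ Γ.sets i) {h h' z : List α}
    (hh : h ∈ I) (hh' : h' ∈ I) (hz : h <+: z) (hz' : h' <+: z) : h = h' := by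
  rcases List.prefix_or_prefix_of_prefix hz hz' with hp | hp
  · exact Γ.no_repeat i I hI _ hh _ hh' hp
  · exact (Γ.no_repeat i I hI _ hh' _ hh hp).symm

theorem prefixIn_eq_of_mem {i : N} {I : Finset (List α)} (hI : I ∈ Γ.sets i) {h z : List α}
    (hh : h ∈ I) (hz : h <+: z) : prefixIn I z = h :=
  prefixIn_eq hh hz fun _ hg hgz => eq_of_prefix hI hg hh hgz hz

theorem IsStrategy.isDistribution {i : N} {s : Behavior α} (hs : Γ.IsStrategy i s) :
    G.IsDistribution i s :=
  fun h hh => ⟨hs.nonneg h hh, hs.sum_eq_one h hh⟩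

/-- The probability of `a` at the information set `J`. -/
def infoProb (s : Behavior α) (p : Finset (List α) × α) : ℝ :=
  if h : p.1.Nonempty then s h.choose p.2 else 0

theorem IsStrategy.infoProb_eq {i : N} {s : Behavior α} (hs : Γ.IsStrategy i s)
    {J : Finset (List α)} (hJ : J ∈ Γ.sets i) {h : List α} (hh : h ∈ J) {a : α}
    (ha : a ∈ G.actionsAt J) : infoProb s (J, a) = s h a := by
  have hne : J.Nonempty := ⟨h, hh⟩
  simp only [infoProb, hne, dif_pos]
  exact hs.const J hJ _ hne.choose_spec _ hh a ha

theorem seq_self (i : N) (z : List α) : Γ.seq i z z = [] := by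
  simp [seq, movesFrom_self]

theorem seq_of_prefix {i : N} {h z : List α} {a : α} (hz : h ++ [a] <+: z) :
    Γ.seq i h z =
      if G.turn h = some i then (Γ.infoSet h, a) :: Γ.seq i (h ++ [a]) z
      else Γ.seq i (h ++ [a]) z := by
  rw [seq, movesFrom_of_prefix hz, seq]
  by_cases hi : G.turn h = some i <;> simp [hi]

theorem mem_seq {i : N} {h z : List α} {p : Finset (List α) × α} :
    p ∈ Γ.seq i h z ↔
      ∃ g, h <+: g ∧ g ++ [p.2] <+: z ∧ G.turn g = some i ∧ Γ.infoSet g = p.1 := by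
  obtain ⟨J, a⟩ := p
  simp only [seq, List.mem_map, List.mem_filter, mem_movesFrom, decide_eq_true_eq, Prod.mk.injEq]
  constructor
  · rintro ⟨⟨g, b⟩, ⟨⟨h1, h2⟩, h3⟩, h4, rfl⟩
    exact ⟨g, h1, h2, h3, h4⟩
  · rintro ⟨g, h1, h2, h3, h4⟩
    exact ⟨(g, a), ⟨⟨h1, h2⟩, h3⟩, h4, rfl⟩

/-- A strategy is constant on information sets, so own reach sees only the sequence X_i. This is how
condition (iv), and perfect recall of the refinement, act on probabilities. -/
theorem IsStrategy.own_eq {i : N} {s : Behavior α} (hs : Γ.IsStrategy i s) {h z : List α}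
    (hz : z ∈ G.hist) : G.own i s h z = ((Γ.seq i h z).map (infoProb s)).prod := by
  rw [own, seq, List.map_map]
  congr 1
  refine List.map_congr_left fun m hm => ?_
  rw [List.mem_filter, mem_movesFrom] at hm
  have hH := hist_of_prefix hz hm.1.2
  have hp := mem_playerHist_of_concat (i := i) hH (by simpa using hm.2)
  rw [Function.comp, hs.infoProb_eq (infoSet_mem_sets hp) (mem_infoSet hp)]
  rw [actionsAt_eq (infoSet_mem_sets hp) (mem_infoSet hp)]
  exact mem_actions.2 hH

/-- The probability of `a` for the player who acts at the information set `J`. -/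
def playProb (σ : N → Behavior α) (p : Finset (List α) × α) : ℝ :=
  if h : p.1.Nonempty then G.moveProb σ (h.choose, p.2) else 0

theorem IsProfile.playProb_eq {σ : N → Behavior α} (hσ : Γ.IsProfile σ) {i : N}
    {J : Finset (List α)} (hJ : J ∈ Γ.sets i) {h : List α} (hh : h ∈ J) {a : α}
    (ha : a ∈ G.actionsAt J) : playProb (G := G) σ (J, a) = G.moveProb σ (h, a) := by
  have hne : J.Nonempty := ⟨h, hh⟩
  have h1 := (mem_playerHist.1 (subset_playerHist hJ hne.choose_spec)).2
  have h2 := (mem_playerHist.1 (subset_playerHist hJ hh)).2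
  simp only [playProb, hne, dif_pos, moveProb, h1, h2]
  exact (hσ i).const J hJ _ hne.choose_spec _ hh a ha

/-- Separates what condition (ii) scales (chance) from what condition (iii) preserves (the
opponents' sequence). -/
theorem IsProfile.reachOthers_eq {σ : N → Behavior α} (hσ : Γ.IsProfile σ) (i : N) {z : List α}
    (hz : z ∈ G.hist) : G.reachOthers i σ z =
      G.reachChance z * ((Γ.seqOthers i z).map (playProb (G := G) σ)).prod := by
  rw [reachOthers, ← prod_map_filter_mul _ (fun m => decide (G.turn m.1 = none)),
    List.filter_filter, List.filter_filter]
  congr 1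
  · rw [reachChance]
    have : (fun m : List α × α => decide (G.turn m.1 = none) && decide (G.turn m.1 ≠ some i)) =
        fun m => decide (G.turn m.1 = none) := by
      funext m
      cases G.turn m.1 <;> simp
    rw [this]
    congr 1
    refine List.map_congr_left fun m hm => ?_
    rw [List.mem_filter] at hm
    have := hm.2
    simp only [decide_eq_true_eq] at this
    simp [moveProb, this]
  · rw [seqOthers, List.map_map]
    have : (fun m : List α × α => !decide (G.turn m.1 = none) && decide (G.turn m.1 ≠ some i)) =
        fun m => decide (G.turn m.1 ≠ some i ∧ G.turn m.1 ≠ none) := by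
      funext m
      cases G.turn m.1 <;> simp
    rw [this]
    congr 1
    refine List.map_congr_left fun m hm => ?_
    rw [List.mem_filter, mem_moves] at hm
    have hH := hist_of_prefix hz hm.1
    obtain ⟨j, hj⟩ := Option.ne_none_iff_exists'.1 (by simpa using hm.2 : _ ∧ G.turn m.1 ≠ none).2
    have hp := mem_playerHist_of_concat hH hj
    rw [Function.comp, hσ.playProb_eq (infoSet_mem_sets hp) (mem_infoSet hp)]
    rw [actionsAt_eq (infoSet_mem_sets hp) (mem_infoSet hp)]
    exact mem_actions.2 hH

end Info

/-! ### Transport of values along a matching -/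

/-- The sum, over the occurrences of `q` in a list, of the product of `f` over the entries after
the occurrence. -/
def prodAfter {β : Type*} [DecidableEq β] (f : β → ℝ) (q : β) : List β → ℝ
  | [] => 0
  | p :: L => (if p = q then (L.map f).prod else 0) + prodAfter f q L

/-- Relabelling keeps the products when it preserves `f` on the list, and keeps the occurrences of
`q` when no other entry is sent to `g q`. -/
theorem prodAfter_map {β : Type*} [DecidableEq β] {f : β → ℝ} {q : β} (g : β → β) {L : List β}
    (hf : ∀ p ∈ L, f (g p) = f p) (hq : ∀ p ∈ L, g p = g q ↔ p = q) :
    prodAfter f (g q) (L.map g) = prodAfter f q L := by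
  induction L with
  | nil => rfl
  | cons p L ih =>
    have h1 : ((L.map g).map f) = L.map f := by
      rw [List.map_map]
      exact List.map_congr_left fun p hp => hf p (by simp [hp])
    simp only [List.map_cons, prodAfter, h1, hq p (by simp)]
    rw [ih (fun p hp => hf p (by simp [hp])) (fun p hp => hq p (by simp [hp]))]

namespace Info

open GameTree

variable {N α : Type*} [DecidableEq N] [Fintype α] [DecidableEq α] {G : GameTree N α}
  {Γ Γ' : Info G}

/-- An occurrence of `(J, a)` in the sequence is a history of `J` on the play at which `a` is taken,
and the product after it is the own reach from there. A sum over histories thus becomes a function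
of the sequence alone, which a matching can transport. -/
theorem IsStrategy.prodAfter_seq {i : N} {s : Behavior α} (hs : Γ.IsStrategy i s)
    {J : Finset (List α)} (hJ : J ∈ Γ.sets i) (a : α) {h z : List α} (hz : z ∈ G.hist)
    (hp : h <+: z) :
    prodAfter (infoProb s) (J, a) (Γ.seq i h z) =
      ∑ g ∈ J, if h <+: g ∧ g ++ [a] <+: z then G.own i s (g ++ [a]) z else 0 := by
  obtain ⟨t, ht⟩ := hp
  induction t generalizing h with
  | nil =>
    rw [List.append_nil] at ht
    subst ht
    rw [seq_self, prodAfter, Finset.sum_eq_zero]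
    intro g _
    rw [if_neg]
    rintro ⟨h1, h2⟩
    have := h1.length_le
    have := h2.length_le
    simp at this
    omega
  | cons b t ih =>
    have hb : h ++ [b] ++ t = z := by simpa using ht
    have hbz : h ++ [b] <+: z := ⟨t, hb⟩
    -- Splits off the first move of the play; the case `h = g`, `b = a` is the head of the sequence.
    have hpt : ∀ g, (if h <+: g ∧ g ++ [a] <+: z then G.own i s (g ++ [a]) z else 0) =
        (if h = g then if b = a then G.own i s (h ++ [b]) z else 0 else 0) +
          if h ++ [b] <+: g ∧ g ++ [a] <+: z then G.own i s (g ++ [a]) z else 0 := by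
      intro g
      have hm : (h <+: g ∧ g ++ [a] <+: z) ↔
          (g, a) = (h, b) ∨ (h ++ [b] <+: g ∧ g ++ [a] <+: z) := by
        have h1 := mem_path (h := h) (t := b :: t) (m := (g, a))
        have h2 := mem_path (h := h ++ [b]) (t := t) (m := (g, a))
        rw [ht] at h1
        rw [hb] at h2
        rw [← h1, ← h2, path, List.mem_cons]
      by_cases hg : h = g ∧ b = a
      · obtain ⟨rfl, rfl⟩ := hg
        have : ¬ h ++ [b] <+: h := fun hc => by simpa using hc.length_le
        simp [this, hbz]
      · have hne : ¬ (g, a) = (h, b) := by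
          rw [Prod.mk.injEq]; rintro ⟨rfl, rfl⟩; exact hg ⟨rfl, rfl⟩
        rw [← ite_and, if_neg hg, zero_add]
        simp only [hm, hne, false_or]
    rw [Finset.sum_congr rfl fun g _ => hpt g, Finset.sum_add_distrib, ← ih hb, seq_of_prefix hbz,
      Finset.sum_ite_eq]
    by_cases hi : G.turn h = some i
    · have hh := mem_playerHist_of_concat (hist_of_prefix hz hbz) hi
      have hJh : Γ.infoSet h = J ↔ h ∈ J :=
        ⟨fun he => he ▸ mem_infoSet hh, fun hm => infoSet_eq hJ hm⟩
      simp only [hi, if_true, prodAfter, Prod.mk.injEq, hJh, ← hs.own_eq hz, ite_and]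
    · have : h ∉ J := fun hm => hi (mem_playerHist.1 (subset_playerHist hJ hm)).2
      simp [hi, this]

/-- The histories in `J` that descend from a history in `S`. -/
def below (S J : Finset (List α)) : Finset (List α) := {g ∈ J | ∃ h ∈ S, h <+: g}

/-- The right-hand side is a sum over Z_S of utility, the others' reach and a function of X_i, which
are exactly the data that a matching controls. -/
theorem IsStrategy.sum_below_histValue {i : N} {σ : N → Behavior α} (hs : Γ.IsStrategy i (σ i))
    {S : Finset (List α)} (hS : S ∈ Γ'.sets i) {J : Finset (List α)} (hJ : J ∈ Γ.sets i) (a : α) :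
    ∑ g ∈ below S J, G.histValue i σ (g ++ [a]) =
      ∑ z ∈ G.terminalsThrough S, G.util i z * G.reachOthers i σ z *
        prodAfter (infoProb (σ i)) (J, a) (Γ.seq i (prefixIn S z) z) := by
  rw [sum_terminalsThrough (Γ'.no_repeat i S hS) (fun h z => G.util i z * G.reachOthers i σ z *
        prodAfter (infoProb (σ i)) (J, a) (Γ.seq i h z))]
  have h1 : ∀ h ∈ S, ∑ z ∈ G.terminals with h <+: z, G.util i z * G.reachOthers i σ z *
        prodAfter (infoProb (σ i)) (J, a) (Γ.seq i h z) =
      ∑ g ∈ J, if h <+: g then G.histValue i σ (g ++ [a]) else 0 := by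
    intro h hh
    have : ∀ z ∈ {z ∈ G.terminals | h <+: z}, G.util i z * G.reachOthers i σ z *
        prodAfter (infoProb (σ i)) (J, a) (Γ.seq i h z) =
        ∑ g ∈ J, if h <+: g ∧ g ++ [a] <+: z then
          G.util i z * G.reachOthers i σ z * G.own i (σ i) (g ++ [a]) z else 0 := by
      intro z hz
      rw [Finset.mem_filter] at hz
      rw [hs.prodAfter_seq hJ a (mem_terminals.1 hz.1).1 hz.2, Finset.mul_sum]
      simp only [mul_ite, mul_zero]
    rw [Finset.sum_congr rfl this, Finset.sum_comm]
    refine Finset.sum_congr rfl fun g _ => ?_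
    by_cases hg : h <+: g
    · simp only [hg, true_and, if_true]
      rw [← Finset.sum_filter, Finset.filter_filter, histValue]
      refine Finset.sum_congr (Finset.filter_congr fun z _ => ⟨fun hz => hz.2, fun hz => ⟨?_, hz⟩⟩)
        fun _ _ => rfl
      exact hg.trans ((List.prefix_append _ _).trans hz)
    · simp [hg]
  rw [Finset.sum_congr rfl h1, Finset.sum_comm, below, Finset.sum_filter]
  refine Finset.sum_congr rfl fun g _ => ?_
  split_ifs with hg
  · obtain ⟨h, hh, hp⟩ := hg
    rw [Finset.sum_eq_single h, if_pos hp]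
    · intro h' hh' hne
      exact if_neg fun hp' => hne (eq_of_prefix hS hh' hh hp' hp)
    · exact fun hn => absurd hh hn
  · exact (Finset.sum_eq_zero fun h hh => if_neg fun hp => hg ⟨h, hh, hp⟩).symm

theorem exists_mem_descendants {i : N} {S : Finset (List α)} (hS : S ∈ Γ'.sets i) {z : List α}
    (hz : z ∈ G.terminalsThrough S) {p : Finset (List α) × α}
    (hp : p ∈ Γ.seq i (prefixIn S z) z) :
    p.1 ∈ Γ.descendants i S ∧ p.2 ∈ G.actionsAt p.1 := by
  rw [terminalsThrough, Finset.mem_filter] at hz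
  obtain ⟨hz, h, hh, hhz⟩ := hz
  rw [prefixIn_eq_of_mem hS hh hhz, mem_seq] at hp
  obtain ⟨g, h1, h2, h3, h4⟩ := hp
  have hH := hist_of_prefix (mem_terminals.1 hz).1 h2
  have hg := mem_playerHist_of_concat hH h3
  rw [← h4]
  refine ⟨Finset.mem_filter.2 ⟨infoSet_mem_sets hg, h, hh, g, mem_infoSet hg, h1⟩, ?_⟩
  rw [actionsAt_eq (infoSet_mem_sets hg) (mem_infoSet hg)]
  exact mem_actions.2 hH

theorem seq_eq_cons {i : N} {I S : Finset (List α)} (hI : I ∈ Γ.sets i) (hS : S ∈ Γ'.sets i)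
    (hSI : S ⊆ I) {z : List α} (hz : z ∈ G.terminalsThrough S) :
    ∃ b L, Γ.seq i (prefixIn S z) z = (I, b) :: L := by
  rw [terminalsThrough, Finset.mem_filter] at hz
  obtain ⟨hz, h, hh, t, rfl⟩ := hz
  have hhI := mem_playerHist.1 (subset_playerHist hS hh)
  rw [prefixIn_eq_of_mem hS hh (List.prefix_append _ _)]
  cases t with
  | nil =>
    rw [List.append_nil, mem_terminals] at hz
    simpa [hz.2] using (mem_decisions.1 hhI.1).2
  | cons b t =>
    rw [seq_of_prefix (a := b) ⟨t, by simp⟩, if_pos hhI.2, infoSet_eq hI (hSI hh)]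
    exact ⟨_, _, rfl⟩

/-- `φ`, `ψ` and `ω` match the play below `S` with the play below `S'`, where both sets belong to
the information set `I` of player `i`; utility times chance is scaled by `c`. -/
structure IsMatching (Γ : Info G) (i : N) (I S S' : Finset (List α)) (c : ℝ)
    (φ : List α → List α) (ψ : Finset (List α) → Finset (List α))
    (ω : Finset (List α) → α → α) : Prop where
  bijOn_terminals : Set.BijOn φ (G.terminalsThrough S) (G.terminalsThrough S')
  bijOn_descendants : Set.BijOn ψ (Γ.descendants i S) (Γ.descendants i S')
  bijOn_actions : ∀ J ∈ Γ.descendants i S, Set.BijOn (ω J) (G.actionsAt J) (G.actionsAt (ψ J))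
  action_self : ∀ a ∈ G.actionsAt I, ω I a = a
  weight : ∀ z ∈ G.terminalsThrough S,
    G.util i z * G.reachChance z = c * (G.util i (φ z) * G.reachChance (φ z))
  seqOthers : ∀ z ∈ G.terminalsThrough S, Γ.seqOthers i z = Γ.seqOthers i (φ z)
  seq : ∀ z ∈ G.terminalsThrough S, Γ.seq i (prefixIn S' (φ z)) (φ z) =
    (Γ.seq i (prefixIn S z) z).map fun p => (ψ p.1, ω p.1 p.2)

namespace IsMatching

variable {i : N} {I S S' : Finset (List α)} {c : ℝ} {φ : List α → List α}
  {ψ : Finset (List α) → Finset (List α)} {ω : Finset (List α) → α → α}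

/-- A play through `S` and its image through `S'` both begin their sequences with `I`, and the
matching sends first entry to first entry. -/
theorem info_self (m : Γ.IsMatching i I S S' c φ ψ ω) (hI : I ∈ Γ.sets i) (hS : S ∈ Γ'.sets i)
    (hS' : S' ∈ Γ'.sets i) (hSI : S ⊆ I) (hSI' : S' ⊆ I) : ψ I = I := by
  obtain ⟨h, hh⟩ := nonempty_of_mem_sets hS
  obtain ⟨z, hz, hp⟩ := exists_terminal
    (mem_decisions.1 (mem_playerHist.1 (subset_playerHist hS hh)).1).1
  have hzS : z ∈ G.terminalsThrough S := Finset.mem_filter.2 ⟨hz, h, hh, hp⟩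
  obtain ⟨b, L, h1⟩ := seq_eq_cons hI hS hSI hzS
  obtain ⟨b', L', h2⟩ := seq_eq_cons hI hS' hSI' (m.bijOn_terminals.mapsTo hzS)
  have := m.seq z hzS
  rw [h1, h2] at this
  simp only [List.map_cons, List.cons.injEq, Prod.mk.injEq] at this
  exact this.1.1.symm

/-- Reindex the terminals by `φ`: the opponents' factor is unchanged, utility times chance scales by
`c`, and the own factor is unchanged by the assumption `hf` on action probabilities. -/
theorem sum_below_histValue (m : Γ.IsMatching i I S S' c φ ψ ω) (hS : S ∈ Γ'.sets i)
    (hS' : S' ∈ Γ'.sets i) {σ : N → Behavior α} (hσ : Γ.IsProfile σ)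
    (hf : ∀ J ∈ Γ.descendants i S, ∀ a ∈ G.actionsAt J,
      infoProb (σ i) (ψ J, ω J a) = infoProb (σ i) (J, a))
    {J : Finset (List α)} (hJ : J ∈ Γ.descendants i S) {a : α} (ha : a ∈ G.actionsAt J) :
    ∑ g ∈ below S J, G.histValue i σ (g ++ [a]) =
      c * ∑ g ∈ below S' (ψ J), G.histValue i σ (g ++ [ω J a]) := by
  rw [(hσ i).sum_below_histValue hS (Finset.mem_filter.1 hJ).1,
    (hσ i).sum_below_histValue hS' (Finset.mem_filter.1 (m.bijOn_descendants.mapsTo hJ)).1,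
    Finset.mul_sum]
  refine Finset.sum_bij (fun z _ => φ z) (fun z hz => m.bijOn_terminals.mapsTo hz)
    (fun z hz z' hz' => m.bijOn_terminals.injOn hz hz')
    (fun z hz => by simpa using m.bijOn_terminals.surjOn hz) fun z hz => ?_
  have hzH := (mem_terminals.1 (Finset.mem_filter.1 hz).1).1
  have hzH' := (mem_terminals.1 (Finset.mem_filter.1 (m.bijOn_terminals.mapsTo hz)).1).1
  have h1 := prodAfter_map (f := infoProb (σ i)) (q := (J, a)) (fun p => (ψ p.1, ω p.1 p.2))
    (L := Γ.seq i (prefixIn S z) z)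
    (fun p hp => by
      obtain ⟨h1, h2⟩ := exists_mem_descendants hS hz hp
      exact hf p.1 h1 p.2 h2)
    (fun p hp => by
      obtain ⟨h1, h2⟩ := exists_mem_descendants hS hz hp
      obtain ⟨J', b⟩ := p
      simp only [Prod.mk.injEq]
      constructor
      · rintro ⟨h3, h4⟩
        have := m.bijOn_descendants.injOn h1 hJ h3
        subst this
        exact ⟨rfl, (m.bijOn_actions _ h1).injOn h2 ha h4⟩
      · rintro ⟨rfl, rfl⟩; exact ⟨rfl, rfl⟩)
  rw [m.seq z hz, h1, hσ.reachOthers_eq i hzH, hσ.reachOthers_eq i hzH', ← m.seqOthers z hz,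
    ← mul_assoc, m.weight z hz]
  ring

theorem sum_below_advantage (m : Γ.IsMatching i I S S' c φ ψ ω) (hS : S ∈ Γ'.sets i)
    (hS' : S' ∈ Γ'.sets i) {σ : N → Behavior α} (hσ : Γ.IsProfile σ)
    (hf : ∀ J ∈ Γ.descendants i S, ∀ a ∈ G.actionsAt J,
      infoProb (σ i) (ψ J, ω J a) = infoProb (σ i) (J, a))
    {J : Finset (List α)} (hJ : J ∈ Γ.descendants i S) {a : α} (ha : a ∈ G.actionsAt J) :
    ∑ g ∈ below S J, (G.histValue i σ (g ++ [a]) - G.histValue i σ g) =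
      c * ∑ g ∈ below S' (ψ J), (G.histValue i σ (g ++ [ω J a]) - G.histValue i σ g) := by
  -- The value at a history of player i is the average of the values after each action, with weights
  -- common to the whole information set; the average can then be reindexed by `ω J`.
  have key : ∀ S₀ : Finset (List α), ∀ J₀ ∈ Γ.sets i, ∑ g ∈ below S₀ J₀, G.histValue i σ g =
      ∑ b ∈ G.actionsAt J₀, infoProb (σ i) (J₀, b) *
        ∑ g ∈ below S₀ J₀, G.histValue i σ (g ++ [b]) := by
    intro S₀ J₀ hJ₀
    simp only [Finset.mul_sum]
    rw [Finset.sum_comm]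
    refine Finset.sum_congr rfl fun g hg => ?_
    have hg := (Finset.mem_filter.1 hg).1
    rw [histValue_player _ _ _ (subset_playerHist hJ₀ hg), actionsAt_eq hJ₀ hg]
    refine Finset.sum_congr rfl fun b hb => ?_
    rw [(hσ i).infoProb_eq hJ₀ hg (by rwa [actionsAt_eq hJ₀ hg])]
  rw [Finset.sum_sub_distrib, Finset.sum_sub_distrib, mul_sub,
    m.sum_below_histValue hS hS' hσ hf hJ ha,
    key S J (Finset.mem_filter.1 hJ).1,
    key S' (ψ J) (Finset.mem_filter.1 (m.bijOn_descendants.mapsTo hJ)).1]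
  congr 1
  rw [Finset.mul_sum]
  refine Finset.sum_bij (fun b _ => ω J b) (fun b hb => (m.bijOn_actions J hJ).mapsTo hb)
    (fun b hb b' hb' => (m.bijOn_actions J hJ).injOn hb hb')
    (fun b hb => by simpa using (m.bijOn_actions J hJ).surjOn hb) fun b hb => ?_
  rw [hf J hJ b hb, m.sum_below_histValue hS hS' hσ hf hJ hb]
  ring

end IsMatching

end Info

/-! ### Proportional advantages, and CFR playing alike at matched sets -/

namespace GameTree

variable {N α : Type*} [DecidableEq N] [Fintype α] [DecidableEq α] (G : GameTree N α)

/-- The advantage of `a` over `σ_i`, summed over the histories in `S`. -/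
def advantage (i : N) (σ : N → Behavior α) (S : Finset (List α)) (a : α) : ℝ :=
  ∑ h ∈ S, (G.histValue i σ (h ++ [a]) - G.histValue i σ h)

/-- The total advantage of `a` over `σ^t_i` for `t = 1, …, T`. -/
def cumAdvantage (i : N) (σ : ℕ → N → Behavior α) (T : ℕ) (S : Finset (List α)) (a : α) : ℝ :=
  ∑ t ∈ Finset.Icc 1 T, G.advantage i (σ t) S a

/-- Utility times chance vanishes at all terminal histories through `S`. -/
def IsNull (i : N) (S : Finset (List α)) : Prop :=
  ∀ z ∈ G.terminalsThrough S, G.util i z * G.reachChance z = 0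

end GameTree

namespace Info

open GameTree

variable {N α : Type*} [DecidableEq N] [Fintype α] [DecidableEq α] {G : GameTree N α}
  {Γ Γ' : Info G}

theorem histValue_eq_zero {i : N} {σ : N → Behavior α} (hσ : Γ.IsProfile σ)
    {S : Finset (List α)} (hS : G.IsNull i S) {g h : List α} (hg : g ∈ S) (hgh : g <+: h) :
    G.histValue i σ h = 0 := by
  refine Finset.sum_eq_zero fun z hz => ?_
  rw [Finset.mem_filter] at hz
  rw [hσ.reachOthers_eq i (mem_terminals.1 hz.1).1, ← mul_assoc,
    hS z (Finset.mem_filter.2 ⟨hz.1, g, hg, hgh.trans hz.2⟩)]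
  simp

theorem advantage_eq_zero {i : N} {σ : N → Behavior α} (hσ : Γ.IsProfile σ)
    {S U : Finset (List α)} (hS : G.IsNull i S) (hU : U ⊆ S) (a : α) :
    G.advantage i σ U a = 0 :=
  Finset.sum_eq_zero fun h hh => by
    rw [histValue_eq_zero hσ hS (hU hh) List.prefix_rfl,
      histValue_eq_zero hσ hS (hU hh) (List.prefix_append _ _), sub_zero]

theorem sum_eq_sum_refinedSets {i : N} {U : Finset (List α)} (hUi : U ⊆ G.playerHist i)
    (hU : ∀ g ∈ U, Γ'.infoSet g ⊆ U) (F : List α → ℝ) :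
    ∑ h ∈ U, F h = ∑ S ∈ refinedSets Γ' i U, ∑ h ∈ S, F h := by
  have : U = (refinedSets Γ' i U).biUnion id := by
    ext h
    simp only [refinedSets, Finset.mem_biUnion, Finset.mem_filter, id]
    constructor
    · exact fun hh => ⟨_, ⟨infoSet_mem_sets (hUi hh), hU h hh⟩, mem_infoSet (hUi hh)⟩
    · rintro ⟨S, ⟨_, hS⟩, hh⟩
      exact hS hh
  conv_lhs => rw [this]
  rw [Finset.sum_biUnion]
  · rfl
  · intro S hS S' hS' hne
    rw [Function.onFun, Finset.disjoint_left]
    intro h h1 h2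
    rw [Finset.mem_coe, refinedSets, Finset.mem_filter] at hS hS'
    exact hne ((infoSet_eq hS.1 h1).symm.trans (infoSet_eq hS'.1 h2))

theorem mem_refinedSets {i : N} {U S : Finset (List α)} :
    S ∈ refinedSets Γ' i U ↔ S ∈ Γ'.sets i ∧ S ⊆ U := by
  simp [refinedSets]

theorem IsPerfectRecallRefinement.infoSet_subset (hr : Γ.IsPerfectRecallRefinement Γ') {i : N}
    {J : Finset (List α)} (hJ : J ∈ Γ.sets i) {g : List α} (hg : g ∈ J) : Γ'.infoSet g ⊆ J := by
  intro g' hg'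
  have h1 := subset_playerHist hJ hg
  have h2 := infoSet_mem_sets (Γ := Γ') h1
  have h3 := subset_playerHist h2 hg'
  have := hr.2 i g h1 g' h3 (infoSet_eq h2 hg').symm
  rw [← infoSet_eq hJ hg, this]
  exact mem_infoSet h3

/-- Under perfect recall, histories in the same refined set share their past sequence. If one of
them has passed through `S`, so have all. -/
theorem IsPerfectRecallRefinement.infoSet_subset_below (hr : Γ.IsPerfectRecallRefinement Γ')
    {i : N} {S J : Finset (List α)} (hS : S ∈ Γ'.sets i) (hJ : J ∈ Γ.sets i) {g : List α}
    (hg : g ∈ below S J) : Γ'.infoSet g ⊆ below S J := by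
  intro g' hg'
  rw [below, Finset.mem_filter] at hg ⊢
  obtain ⟨hg, h, hh, t, rfl⟩ := hg
  have h1 := subset_playerHist hJ hg
  refine ⟨hr.infoSet_subset hJ hg hg', ?_⟩
  cases t with
  | nil =>
    rw [List.append_nil, infoSet_eq hS hh] at hg'
    exact ⟨g', hg', List.prefix_rfl⟩
  | cons b t =>
    have hseq := hr.1 i _ (infoSet_mem_sets h1) _ (mem_infoSet h1) _ hg'
    have hm : (S, b) ∈ Γ'.seq i [] (h ++ b :: t) :=
      mem_seq.2 ⟨h, List.nil_prefix, ⟨t, by simp⟩,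
        (mem_playerHist.1 (subset_playerHist hS hh)).2, infoSet_eq hS hh⟩
    rw [hseq, mem_seq] at hm
    obtain ⟨f, -, h2, h3, h4⟩ := hm
    have h5 := subset_playerHist (infoSet_mem_sets (Γ := Γ') h1) hg'
    have hf := mem_playerHist_of_concat
      (hist_of_prefix (mem_decisions.1 (mem_playerHist.1 h5).1).1 h2) h3
    have h6 := mem_infoSet (Γ := Γ') hf
    rw [h4] at h6
    exact ⟨f, h6, (List.prefix_append _ _).trans h2⟩

theorem below_self {i : N} {I S : Finset (List α)} (hI : I ∈ Γ.sets i) (hSI : S ⊆ I) :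
    below S I = S := by
  ext g
  rw [below, Finset.mem_filter]
  constructor
  · rintro ⟨hg, h, hh, hp⟩
    rwa [← Γ.no_repeat i I hI h (hSI hh) g hg hp]
  · exact fun hg => ⟨hSI hg, g, hg, List.prefix_rfl⟩

namespace IsMatching

variable {i : N} {I S S' : Finset (List α)} {c : ℝ} {φ : List α → List α}
  {ψ : Finset (List α) → Finset (List α)} {ω : Finset (List α) → α → α}

theorem ne_zero (m : Γ.IsMatching i I S S' c φ ψ ω) (hS : ¬ G.IsNull i S) : c ≠ 0 := by
  rintro rfl
  exact hS fun z hz => by rw [m.weight z hz, zero_mul]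

theorem not_isNull (m : Γ.IsMatching i I S S' c φ ψ ω) (hS : ¬ G.IsNull i S) :
    ¬ G.IsNull i S' := fun hS' => hS fun z hz => by
  rw [m.weight z hz, hS' _ (m.bijOn_terminals.mapsTo hz), mul_zero]

/-- `φ` permutes Z_S while scaling |u_i π_c| by `c`, so the nonzero total of |u_i π_c| equals `c`
times itself. -/
theorem eq_one (m : Γ.IsMatching i I S S c φ ψ ω) (hc : 0 ≤ c) (hS : ¬ G.IsNull i S) : c = 1 := by
  set q : List α → ℝ := fun z => |G.util i z * G.reachChance z|
  have h1 : ∑ z ∈ G.terminalsThrough S, q z = c * ∑ z ∈ G.terminalsThrough S, q z := by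
    rw [Finset.mul_sum]
    refine Finset.sum_bij (fun z _ => φ z) (fun z hz => m.bijOn_terminals.mapsTo hz)
      (fun z hz z' hz' => m.bijOn_terminals.injOn hz hz')
      (fun z hz => by simpa using m.bijOn_terminals.surjOn hz) fun z hz => ?_
    simp only [q]
    rw [m.weight z hz, abs_mul, abs_of_nonneg hc]
  have h2 : ∑ z ∈ G.terminalsThrough S, q z ≠ 0 := by
    intro h0
    rw [Finset.sum_eq_zero_iff_of_nonneg fun _ _ => abs_nonneg _] at h0
    exact hS fun z hz => abs_eq_zero.1 (h0 z hz)
  exact (mul_right_cancel₀ h2 (by rw [one_mul]; exact h1)).symm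

end IsMatching

/-- Only the product of the two constants is ever needed. -/
theorem NearlyWellFormed.exists_isMatching {k l : Finset (List α) → Finset (List α) → ℝ≥0}
    (hΓ : Γ.NearlyWellFormed Γ' k l) {i : N} {I S S' : Finset (List α)} (hI : I ∈ Γ.sets i)
    (hS : S ∈ refinedSets Γ' i I) (hS' : S' ∈ refinedSets Γ' i I) :
    ∃ φ ψ ω, Γ.IsMatching i I S S' (k S S' * l S S') φ ψ ω := by
  obtain ⟨φ, ψ, ω, h1, h2, h3, h4, h5⟩ := hΓ.2 i I hI S hS S' hS'
  refine ⟨φ, ψ, ω, h1, h2, h3, h4, fun z hz => ?_, fun z hz => (h5 z hz).2.2.1,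
    fun z hz => (h5 z hz).2.2.2⟩
  rw [(h5 z hz).1, (h5 z hz).2.1]
  ring

/-- Matched descendants of matched information sets carry the same action probabilities. -/
def RespectsMatchings (Γ Γ' : Info G) (k l : Finset (List α) → Finset (List α) → ℝ≥0) (i : N)
    (s : Behavior α) : Prop :=
  ∀ I ∈ Γ.sets i, ∀ S ∈ refinedSets Γ' i I, ∀ S' ∈ refinedSets Γ' i I, ∀ φ ψ ω,
    Γ.IsMatching i I S S' (k S S' * l S S') φ ψ ω → (k S S' * l S S' : ℝ) ≠ 0 →
    ∀ J ∈ Γ.descendants i S, ∀ a ∈ G.actionsAt J,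
      infoProb s (ψ J, ω J a) = infoProb s (J, a)

theorem RespectsMatchings.advantage_eq {k l : Finset (List α) → Finset (List α) → ℝ≥0} {i : N}
    {σ : N → Behavior α} (hs : RespectsMatchings Γ Γ' k l i (σ i))
    (hΓ : Γ.NearlyWellFormed Γ' k l) (hσ : Γ.IsProfile σ) {I S S' : Finset (List α)}
    (hI : I ∈ Γ.sets i) (hS : S ∈ refinedSets Γ' i I) (hS' : S' ∈ refinedSets Γ' i I) {a : α}
    (ha : a ∈ G.actionsAt I) :
    G.advantage i σ S a = k S S' * l S S' * G.advantage i σ S' a := by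
  obtain ⟨φ, ψ, ω, m⟩ := hΓ.exists_isMatching hI hS hS'
  obtain ⟨h1, h2⟩ := mem_refinedSets.1 hS
  obtain ⟨h1', h2'⟩ := mem_refinedSets.1 hS'
  -- If the factor is zero, `S` is null and its advantage vanishes; otherwise the matching is
  -- applied at `J = I`, which it maps to itself with the identity on actions.
  by_cases hc : (k S S' * l S S' : ℝ) = 0
  · rw [hc, zero_mul]
    refine advantage_eq_zero hσ (S := S) ?_ subset_rfl a
    by_contra hn
    exact m.ne_zero hn hc
  · have hID : I ∈ Γ.descendants i S := by
      obtain ⟨h, hh⟩ := nonempty_of_mem_sets h1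
      exact Finset.mem_filter.2 ⟨hI, h, hh, h, h2 hh, List.prefix_rfl⟩
    have := m.sum_below_advantage h1 h1' hσ (hs I hI S hS S' hS' φ ψ ω m hc) hID ha
    rwa [m.info_self hI h1 h1' h2 h2', below_self hI h2, below_self hI h2', m.action_self a ha]
      at this

section CFR

variable {k l : Finset (List α) → Finset (List α) → ℝ≥0} {i : N} {σ : ℕ → N → Behavior α} {T : ℕ}

theorem cumAdvantage_eq (hΓ : Γ.NearlyWellFormed Γ' k l) (hσ : ∀ t, 1 ≤ t → Γ.IsProfile (σ t))
    (hs : ∀ t ∈ Finset.Icc 1 T, RespectsMatchings Γ Γ' k l i (σ t i)) {I S S' : Finset (List α)}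
    (hI : I ∈ Γ.sets i) (hS : S ∈ refinedSets Γ' i I) (hS' : S' ∈ refinedSets Γ' i I) {a : α}
    (ha : a ∈ G.actionsAt I) :
    G.cumAdvantage i σ T S a = k S S' * l S S' * G.cumAdvantage i σ T S' a := by
  rw [cumAdvantage, cumAdvantage, Finset.mul_sum]
  exact Finset.sum_congr rfl fun t ht =>
    (hs t ht).advantage_eq hΓ (hσ t (Finset.mem_Icc.1 ht).1) hI hS hS' ha

theorem cumAdvantage_eq_sum {U : Finset (List α)} (hUi : U ⊆ G.playerHist i)
    (hU : ∀ g ∈ U, Γ'.infoSet g ⊆ U) (a : α) :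
    G.cumAdvantage i σ T U a = ∑ S ∈ refinedSets Γ' i U, G.cumAdvantage i σ T S a := by
  simp only [cumAdvantage, advantage]
  conv_rhs => rw [Finset.sum_comm]
  exact Finset.sum_congr rfl fun t _ => sum_eq_sum_refinedSets hUi hU _

/-- Some refined set of `I` carries nonzero weight. Matching it with the others makes all of them
non-null, and a matching out of a non-null set has a nonzero factor. -/
theorem pos_of_not_isNull (hΓ : Γ.NearlyWellFormed Γ' k l) {I S S' : Finset (List α)}
    (hI : I ∈ Γ.sets i) (hn : ¬ G.IsNull i I) (hS : S ∈ refinedSets Γ' i I)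
    (hS' : S' ∈ refinedSets Γ' i I) : (0 : ℝ) < k S S' * l S S' ∧ ¬ G.IsNull i S := by
  obtain ⟨z, hz, hz0⟩ : ∃ z ∈ G.terminalsThrough I, G.util i z * G.reachChance z ≠ 0 := by
    simpa [IsNull] using hn
  obtain ⟨hz, h, hh, hp⟩ := Finset.mem_filter.1 hz
  have hhi := subset_playerHist hI hh
  have hS₀ : Γ'.infoSet h ∈ refinedSets Γ' i I :=
    mem_refinedSets.2 ⟨infoSet_mem_sets hhi, hΓ.1.infoSet_subset hI hh⟩
  have hn₀ : ¬ G.IsNull i (Γ'.infoSet h) := fun h0 =>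
    hz0 (h0 z (Finset.mem_filter.2 ⟨hz, h, mem_infoSet hhi, hp⟩))
  obtain ⟨_, _, _, m₀⟩ := hΓ.exists_isMatching hI hS₀ hS
  obtain ⟨_, _, _, m⟩ := hΓ.exists_isMatching hI hS hS'
  have hnS := m₀.not_isNull hn₀
  exact ⟨lt_of_le_of_ne (by positivity) (m.ne_zero hnS).symm, hnS⟩

/-- The regrets at an information set are positive multiples of the advantages on any part of it
that is made up of sets of the refinement. -/
theorem exists_pos_cumAdvantage_eq (hΓ : Γ.NearlyWellFormed Γ' k l)
    (hσ : ∀ t, 1 ≤ t → Γ.IsProfile (σ t))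
    (hs : ∀ t ∈ Finset.Icc 1 T, RespectsMatchings Γ Γ' k l i (σ t i)) {I U : Finset (List α)}
    (hI : I ∈ Γ.sets i) (hUI : U ⊆ I) (hU : ∀ g ∈ U, Γ'.infoSet g ⊆ U) (hne : U.Nonempty) :
    ∃ c : ℝ, 0 < c ∧ ∀ a ∈ G.actionsAt I,
      G.cumAdvantage i σ T I a = c * G.cumAdvantage i σ T U a := by
  by_cases hn : G.IsNull i I
  · refine ⟨1, one_pos, fun a _ => ?_⟩
    have hz : ∀ V ⊆ I, G.cumAdvantage i σ T V a = 0 := fun V hV =>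
      Finset.sum_eq_zero fun t ht => advantage_eq_zero (hσ t (Finset.mem_Icc.1 ht).1) hn hV a
    rw [hz I subset_rfl, hz U hUI, mul_zero]
  · have hIi := subset_playerHist hI
    obtain ⟨g, hg⟩ := hne
    have hS₀ : Γ'.infoSet g ∈ refinedSets Γ' i U :=
      mem_refinedSets.2 ⟨infoSet_mem_sets (hIi (hUI hg)), hU g hg⟩
    set S₀ := Γ'.infoSet g
    -- A union of refined sets has as advantage the sum of its pieces, each a positive multiple of
    -- that of `S₀`. Comparing both `U` and `I` with `S₀` gives the ratio.
    have key : ∀ V ⊆ I, (∀ g ∈ V, Γ'.infoSet g ⊆ V) → S₀ ∈ refinedSets Γ' i V →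
        ∃ c : ℝ, 0 < c ∧ ∀ a ∈ G.actionsAt I,
          G.cumAdvantage i σ T V a = c * G.cumAdvantage i σ T S₀ a := by
      intro V hV hV' hS
      have hsub : ∀ S ∈ refinedSets Γ' i V, S ∈ refinedSets Γ' i I := fun S hS =>
        mem_refinedSets.2 ⟨(mem_refinedSets.1 hS).1, (mem_refinedSets.1 hS).2.trans hV⟩
      refine ⟨∑ S ∈ refinedSets Γ' i V, (k S S₀ * l S S₀ : ℝ), ?_, fun a ha => ?_⟩
      · exact Finset.sum_pos
          (fun S hS' => (pos_of_not_isNull hΓ hI hn (hsub S hS') (hsub _ hS)).1) ⟨_, hS⟩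
      · rw [cumAdvantage_eq_sum (hV.trans hIi) hV', Finset.sum_mul]
        exact Finset.sum_congr rfl fun S hS' =>
          cumAdvantage_eq hΓ hσ hs hI (hsub S hS') (hsub _ hS) ha
    obtain ⟨c, hc, hcU⟩ := key U hUI hU hS₀
    obtain ⟨d, hd, hdI⟩ := key I subset_rfl (fun g hg => hΓ.1.infoSet_subset hI hg)
      (mem_refinedSets.2 ⟨(mem_refinedSets.1 hS₀).1, (mem_refinedSets.1 hS₀).2.trans hUI⟩)
    refine ⟨d / c, div_pos hd hc, fun a ha => ?_⟩
    rw [hcU a ha, hdI a ha]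
    field_simp

theorem cfRegret_eq_cumAdvantage {I : Finset (List α)} (hI : I ∈ Γ.sets i) {a : α}
    (ha : a ∈ G.actionsAt I) : G.cfRegret i σ T I a = G.cumAdvantage i σ T I a :=
  cfRegret_eq σ T (subset_playerHist hI) (Γ.no_repeat i I hI) fun h hh => by
    rwa [← actionsAt_eq hI hh]

/-- CFR plays alike at information sets whose regrets are proportional. -/
theorem FollowsCFR.infoProb_eq (hcfr : Γ.FollowsCFR i σ) {J J' : Finset (List α)}
    (hJ : J ∈ Γ.sets i) (hJ' : J' ∈ Γ.sets i) {ω : α → α}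
    (hω : Set.BijOn ω (G.actionsAt J) (G.actionsAt J')) {c : ℝ} (hc : 0 < c)
    (hR : ∀ a ∈ G.actionsAt J, G.cfRegret i σ T J a = c * G.cfRegret i σ T J' (ω a)) {a : α}
    (ha : a ∈ G.actionsAt J) :
    infoProb (σ (T + 1) i) (J', ω a) = infoProb (σ (T + 1) i) (J, a) := by
  have hne := nonempty_of_mem_sets hJ
  have hne' := nonempty_of_mem_sets hJ'
  -- Regret matching is homogeneous of degree zero: `c` cancels in the quotient and does not affect
  -- the sign test. In the uniform case the bijection `ω` gives equal numbers of actions.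
  have hmax : ∀ b ∈ G.actionsAt J, max (G.cfRegret i σ T J b) 0 =
      c * max (G.cfRegret i σ T J' (ω b)) 0 := by
    intro b hb
    rw [hR b hb, mul_max_of_nonneg _ _ hc.le, mul_zero]
  have hsum : ∑ b ∈ G.actionsAt J, max (G.cfRegret i σ T J b) 0 =
      c * ∑ b ∈ G.actionsAt J', max (G.cfRegret i σ T J' b) 0 := by
    rw [Finset.mul_sum]
    exact Finset.sum_bij (fun b _ => ω b) (fun b hb => hω.mapsTo hb)
      (fun b hb b' hb' => hω.injOn hb hb') (fun b hb => by simpa using hω.surjOn hb) hmax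
  have hcard : (G.actionsAt J).card = (G.actionsAt J').card :=
    Finset.card_bij (fun b _ => ω b) (fun b hb => hω.mapsTo hb)
      (fun b hb b' hb' => hω.injOn hb hb') (fun b hb => by simpa using hω.surjOn hb)
  simp only [infoProb, hne, hne', dif_pos]
  rw [hcfr T J hJ _ hne.choose_spec a ha, hcfr T J' hJ' _ hne'.choose_spec _ (hω.mapsTo ha),
    hsum, hmax a ha, hcard]
  simp only [mul_pos_iff_of_pos_left hc]
  rw [mul_div_mul_left _ _ hc.ne']

/-- Induction on the round: the strategy of round `T + 1` depends only on regrets from rounds up to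
`T`, and equal play in those rounds makes the regrets at matched sets proportional. -/
theorem FollowsCFR.respectsMatchings (hcfr : Γ.FollowsCFR i σ) (hΓ : Γ.NearlyWellFormed Γ' k l)
    (hσ : ∀ t, 1 ≤ t → Γ.IsProfile (σ t)) {t : ℕ} (ht : 1 ≤ t) :
    RespectsMatchings Γ Γ' k l i (σ t i) := by
  induction t using Nat.strong_induction_on with
  | _ t ih =>
  obtain ⟨T, rfl⟩ := Nat.exists_eq_add_of_le' ht
  have hs : ∀ t ∈ Finset.Icc 1 T, RespectsMatchings Γ Γ' k l i (σ t i) := fun t ht =>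
    ih t (by rw [Finset.mem_Icc] at ht; omega) (Finset.mem_Icc.1 ht).1
  intro I hI S hS S' hS' φ ψ ω m hc J hJ a ha
  have hcp : (0 : ℝ) < k S S' * l S S' := lt_of_le_of_ne (by positivity) hc.symm
  have h1 := (mem_refinedSets.1 hS).1
  have h1' := (mem_refinedSets.1 hS').1
  have hJ' := m.bijOn_descendants.mapsTo hJ
  have hproj : ∀ S₀ ∈ Γ'.sets i, ∀ J₀ ∈ Γ.descendants i S₀, ∃ c : ℝ, 0 < c ∧
      ∀ a ∈ G.actionsAt J₀,
        G.cumAdvantage i σ T J₀ a = c * G.cumAdvantage i σ T (below S₀ J₀) a := by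
    intro S₀ hS₀ J₀ hJ₀
    obtain ⟨hJ₀, h, hh, g, hg, hp⟩ := Finset.mem_filter.1 hJ₀
    exact exists_pos_cumAdvantage_eq hΓ hσ hs hJ₀ (Finset.filter_subset _ _)
      (fun g hg => hΓ.1.infoSet_subset_below hS₀ hJ₀ hg) ⟨g, Finset.mem_filter.2 ⟨hg, h, hh, hp⟩⟩
  obtain ⟨c, hc0, hcJ⟩ := hproj S h1 J hJ
  obtain ⟨d, hd0, hdJ⟩ := hproj S' h1' (ψ J) hJ'
  -- The factor chains three comparisons: `J` with its part below `S`, that part with the part of `ψ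
  -- J` below `S'`, and the latter with all of `ψ J`.
  refine hcfr.infoProb_eq (Finset.mem_filter.1 hJ).1 (Finset.mem_filter.1 hJ').1
    (m.bijOn_actions J hJ) (c := c * (k S S' * l S S') / d) (by positivity) (fun b hb => ?_) ha
  have hωb := (m.bijOn_actions J hJ).mapsTo hb
  rw [cfRegret_eq_cumAdvantage (Finset.mem_filter.1 hJ).1 hb,
    cfRegret_eq_cumAdvantage (Finset.mem_filter.1 hJ').1 hωb, hcJ b hb, hdJ _ hωb]
  have : G.cumAdvantage i σ T (below S J) b =
      k S S' * l S S' * G.cumAdvantage i σ T (below S' (ψ J)) (ω J b) := by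
    rw [cumAdvantage, cumAdvantage, Finset.mul_sum]
    exact Finset.sum_congr rfl fun t ht => m.sum_below_advantage h1 h1'
      (hσ t (Finset.mem_Icc.1 ht).1) (hs t ht I hI S hS S' hS' φ ψ ω m hc) hJ hb
  rw [this]
  field_simp

end CFR

end Info

/-! ### The contribution of one information set, and the final bound -/

namespace Info

open GameTree

variable {N α : Type*} [DecidableEq N] [Fintype α] [DecidableEq α] {G : GameTree N α}
  {Γ Γ' : Info G} {k l : Finset (List α) → Finset (List α) → ℝ≥0} {i : N}
  {σ : ℕ → N → Behavior α} {T : ℕ}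

theorem PerfectRecall.own_eq (hr : Γ'.PerfectRecall) {s : Behavior α} (hs : Γ'.IsStrategy i s)
    {S : Finset (List α)} (hS : S ∈ Γ'.sets i) {h h' : List α} (hh : h ∈ S) (hh' : h' ∈ S) :
    G.own i s [] h = G.own i s [] h' := by
  have hH : ∀ g ∈ S, g ∈ G.hist := fun g hg =>
    (mem_decisions.1 (mem_playerHist.1 (subset_playerHist hS hg)).1).1
  rw [hs.own_eq (hH h hh), hs.own_eq (hH h' hh'), hr i S hS h hh h' hh']

/-- The positive regrets are proportional to the CFR probabilities, whose average advantage vanishes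
at every single history of `I`, not only in the sum over `I`. Hence arbitrary weights `w` are
allowed, in particular the reach of a deviation. -/
theorem FollowsCFR.sum_max_mul_eq_zero (hcfr : Γ.FollowsCFR i σ) {I : Finset (List α)}
    (hσ : Γ.IsProfile (σ (T + 1))) (hI : I ∈ Γ.sets i) (w : List α → ℝ) :
    ∑ a ∈ G.actionsAt I, max (G.cumAdvantage i σ T I a) 0 *
      ∑ h ∈ I, w h * (G.histValue i (σ (T + 1)) (h ++ [a]) - G.histValue i (σ (T + 1)) h) = 0 := by
  have hR : ∀ a ∈ G.actionsAt I, G.cfRegret i σ T I a = G.cumAdvantage i σ T I a :=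
    fun a ha => cfRegret_eq_cumAdvantage hI ha
  have hsum : ∑ a ∈ G.actionsAt I, max (G.cfRegret i σ T I a) 0 =
      ∑ a ∈ G.actionsAt I, max (G.cumAdvantage i σ T I a) 0 :=
    Finset.sum_congr rfl fun a ha => by rw [hR a ha]
  by_cases hpos : 0 < ∑ a ∈ G.actionsAt I, max (G.cumAdvantage i σ T I a) 0
  · simp only [Finset.mul_sum]
    rw [Finset.sum_comm]
    refine Finset.sum_eq_zero fun h hh => ?_
    have hp : ∀ a ∈ G.actionsAt I, max (G.cumAdvantage i σ T I a) 0 =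
        (∑ a ∈ G.actionsAt I, max (G.cumAdvantage i σ T I a) 0) * σ (T + 1) i h a := by
      intro a ha
      rw [hcfr T I hI h hh a ha, hsum, hR a ha, if_pos hpos]
      field_simp
    set R := ∑ a ∈ G.actionsAt I, max (G.cumAdvantage i σ T I a) 0
    have hhi := subset_playerHist hI hh
    calc _ = ∑ a ∈ G.actionsAt I, R * w h * (σ (T + 1) i h a *
          G.histValue i (σ (T + 1)) (h ++ [a]) - σ (T + 1) i h a * G.histValue i (σ (T + 1)) h) :=
          Finset.sum_congr rfl fun a ha => by rw [hp a ha]; ring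
      _ = 0 := by
        rw [← Finset.mul_sum, Finset.sum_sub_distrib, ← Finset.sum_mul, actionsAt_eq hI hh,
          ← histValue_player _ _ _ hhi, (hσ i).sum_eq_one h hhi]
        ring
  · have h0 : ∑ a ∈ G.actionsAt I, max (G.cumAdvantage i σ T I a) 0 = 0 :=
      le_antisymm (not_lt.1 hpos) (Finset.sum_nonneg fun _ _ => le_max_right _ _)
    rw [Finset.sum_eq_zero_iff_of_nonneg fun _ _ => le_max_right _ _] at h0
    exact Finset.sum_eq_zero fun a ha => by rw [h0 a ha, zero_mul]

/-- The part of the gain of a strategy of the refinement that is due to one information set. -/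
theorem FollowsCFR.sum_gain_le (hcfr : Γ.FollowsCFR i σ) (hΓ : Γ.NearlyWellFormed Γ' k l)
    (hσ : ∀ t, 1 ≤ t → Γ.IsProfile (σ t)) {s : Behavior α} (hs : Γ'.IsStrategy i s)
    {I : Finset (List α)} (hI : I ∈ Γ.sets i) :
    ∑ t ∈ Finset.Icc 1 T, ∑ h ∈ I, G.own i s [] h *
        (∑ a ∈ G.actions h, s h a * G.histValue i (σ t) (h ++ [a]) - G.histValue i (σ t) h) ≤
      G.utilRange i * √((G.actionsAt I).card * T) := by
  have hIi := subset_playerHist hI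
  have hsat : ∀ g ∈ I, Γ'.infoSet g ⊆ I := fun g hg => hΓ.1.infoSet_subset hI hg
  have hH : ∀ h ∈ I, h ∈ G.hist := fun h hh =>
    (mem_decisions.1 (mem_playerHist.1 (hIi hh)).1).1
  obtain ⟨h₀, hh₀⟩ := nonempty_of_mem_sets hI
  set S₀ := Γ'.infoSet h₀ with hS₀def
  have hS₀ : S₀ ∈ refinedSets Γ' i I :=
    mem_refinedSets.2 ⟨infoSet_mem_sets (hIi hh₀), hsat h₀ hh₀⟩
  have hresp : ∀ T, ∀ t ∈ Finset.Icc 1 T, RespectsMatchings Γ Γ' k l i (σ t i) := fun T t ht =>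
    hcfr.respectsMatchings hΓ hσ (Finset.mem_Icc.1 ht).1
  set w : Finset (List α) → ℝ := fun S => if h : S.Nonempty then G.own i s [] h.choose else 0
  have hw : ∀ S ∈ refinedSets Γ' i I, ∀ h ∈ S, G.own i s [] h = w S := by
    intro S hS h hh
    have hne : S.Nonempty := ⟨h, hh⟩
    simp only [w, hne, dif_pos]
    exact hΓ.1.1.own_eq hs (mem_refinedSets.1 hS).1 hh hne.choose_spec
  have hw0 : ∀ S ∈ refinedSets Γ' i I, 0 ≤ w S := by
    intro S hS
    obtain ⟨h, hh⟩ := nonempty_of_mem_sets (mem_refinedSets.1 hS).1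
    rw [← hw S hS h hh]
    exact hs.isDistribution.own_nonneg (hH h ((mem_refinedSets.1 hS).2 hh))
  -- The weighted advantages of `I`, cumulated over rounds, are `W` times those of the reference set
  -- `S₀`.
  set W := ∑ S ∈ refinedSets Γ' i I, w S * (k S S₀ * l S S₀)
  have hW : 0 ≤ W := Finset.sum_nonneg fun S hS => mul_nonneg (hw0 S hS) (by positivity)
  set y : ℕ → α → ℝ := fun t a =>
    ∑ h ∈ I, G.own i s [] h * (G.histValue i (σ t) (h ++ [a]) - G.histValue i (σ t) h)
  have hy : ∀ T, ∀ a ∈ G.actionsAt I,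
      ∑ t ∈ Finset.Icc 1 T, y t a = W * G.cumAdvantage i σ T S₀ a := by
    intro T a ha
    have h1 : ∀ t, y t a = ∑ S ∈ refinedSets Γ' i I, w S * G.advantage i (σ t) S a := by
      intro t
      simp only [y]
      rw [sum_eq_sum_refinedSets hIi hsat]
      refine Finset.sum_congr rfl fun S hS => ?_
      rw [advantage, Finset.mul_sum]
      exact Finset.sum_congr rfl fun h hh => by rw [hw S hS h hh]
    simp only [h1]
    rw [Finset.sum_comm, Finset.sum_mul]
    refine Finset.sum_congr rfl fun S hS => ?_
    rw [← Finset.mul_sum, mul_assoc, ← cumAdvantage_eq hΓ hσ (hresp T) hI hS hS₀ ha, cumAdvantage]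
  have hA : (G.actionsAt I).Nonempty := by
    rw [actionsAt_eq hI hh₀]
    exact (mem_decisions.1 (mem_playerHist.1 (hIi hh₀)).1).2
  -- By proportionality with nonnegative factors, this one action is best on every refined set of
  -- `I`, so choosing different actions on different refined sets gains nothing.
  obtain ⟨b, hb, hbmax⟩ := Finset.exists_max_image (G.actionsAt I)
    (fun a => G.cumAdvantage i σ T S₀ a) hA
  have hbound : W * G.cumAdvantage i σ T S₀ b ≤
      G.utilRange i * √((G.actionsAt I).card * T) := by
    rw [← hy T b hb]
    refine regretMatching_bound (G.actionsAt I) y (utilRange_nonneg i) T ?_ ?_ hb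
    · intro t ht a ha
      exact abs_sum_own_mul_histValue_le
        (fun j => (hσ t (Finset.mem_Icc.1 ht).1 j).isDistribution) hs.isDistribution hIi
        (Γ.no_repeat i I hI) fun h hh => by rwa [← actionsAt_eq hI hh]
    · intro t _
      obtain ⟨c, hc, hcI⟩ := exists_pos_cumAdvantage_eq hΓ hσ (hresp t) hI
        (mem_refinedSets.1 hS₀).2 (fun g hg => by
          rw [infoSet_eq (mem_refinedSets.1 hS₀).1 hg])
        (nonempty_of_mem_sets (mem_refinedSets.1 hS₀).1)
      -- The positive part of the cumulated `y` is that of `W` times the advantage of `S₀`, hence `W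
      -- / c` times the positive regret at `I` with which CFR plays.
      refine Eq.trans ?_ ((congrArg (W / c * ·) (hcfr.sum_max_mul_eq_zero (T := t)
        (hσ _ (by omega)) hI fun h => G.own i s [] h)).trans (mul_zero _))
      rw [Finset.mul_sum]
      refine Finset.sum_congr rfl fun a ha => ?_
      rw [hy t a ha, ← mul_assoc, mul_max_of_nonneg _ _ (div_nonneg hW hc.le), mul_zero, hcI a ha,
        ← mul_assoc (W / c), div_mul_cancel₀ W hc.ne']
  -- The gain at `I` is regrouped by refined sets, on each of which both own reach and the action
  -- probabilities of `s` are constant.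
  refine le_trans (le_of_eq ?_) (le_trans (b := ∑ S ∈ refinedSets Γ' i I,
    w S * ∑ a ∈ G.actionsAt I, infoProb s (S, a) * G.cumAdvantage i σ T S a) le_rfl ?_)
  · have h1 : ∀ t, ∑ h ∈ I, G.own i s [] h *
        (∑ a ∈ G.actions h, s h a * G.histValue i (σ t) (h ++ [a]) - G.histValue i (σ t) h) =
        ∑ S ∈ refinedSets Γ' i I,
          w S * ∑ a ∈ G.actionsAt I, infoProb s (S, a) * G.advantage i (σ t) S a := by
      intro t
      rw [sum_eq_sum_refinedSets hIi hsat]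
      refine Finset.sum_congr rfl fun S hS => ?_
      obtain ⟨hS', hSI⟩ := mem_refinedSets.1 hS
      simp only [advantage, Finset.mul_sum]
      rw [Finset.sum_comm]
      refine Finset.sum_congr rfl fun h hh => ?_
      have h2 : G.histValue i (σ t) h = ∑ a ∈ G.actions h, s h a * G.histValue i (σ t) h := by
        rw [← Finset.sum_mul, hs.sum_eq_one h (hIi (hSI hh)), one_mul]
      rw [hw S hS h hh]
      conv_lhs => rw [h2]
      rw [← Finset.sum_sub_distrib, Finset.mul_sum, actionsAt_eq hI (hSI hh)]
      refine Finset.sum_congr rfl fun a ha => ?_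
      rw [hs.infoProb_eq hS' hh (by rwa [actionsAt_eq hS' hh])]
      ring
    simp only [h1]
    rw [Finset.sum_comm]
    refine Finset.sum_congr rfl fun S _ => ?_
    rw [← Finset.mul_sum, Finset.sum_comm]
    simp only [cumAdvantage, Finset.mul_sum]
  · refine le_trans ?_ hbound
    rw [Finset.sum_mul]
    refine Finset.sum_le_sum fun S hS => ?_
    obtain ⟨hS', hSI⟩ := mem_refinedSets.1 hS
    rw [mul_assoc]
    refine mul_le_mul_of_nonneg_left ?_ (hw0 S hS)
    obtain ⟨h, hh⟩ := nonempty_of_mem_sets hS'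
    have hp : ∀ a ∈ G.actionsAt I, infoProb s (S, a) = s h a := fun a ha =>
      hs.infoProb_eq hS' hh (by rwa [actionsAt_eq hS' hh, ← actionsAt_eq hI (hSI hh)])
    calc ∑ a ∈ G.actionsAt I, infoProb s (S, a) * G.cumAdvantage i σ T S a
        ≤ ∑ a ∈ G.actionsAt I, s h a * (k S S₀ * l S S₀ * G.cumAdvantage i σ T S₀ b) := by
          refine Finset.sum_le_sum fun a ha => ?_
          rw [hp a ha, cumAdvantage_eq hΓ hσ (hresp T) hI hS hS₀ ha]
          refine mul_le_mul_of_nonneg_left (mul_le_mul_of_nonneg_left (hbmax a ha) (by positivity))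
            (hs.nonneg h (hIi (hSI hh)) a ?_)
          rwa [← actionsAt_eq hI (hSI hh)]
      _ = k S S₀ * l S S₀ * G.cumAdvantage i σ T S₀ b := by
          rw [← Finset.sum_mul, actionsAt_eq hI (hSI hh), hs.sum_eq_one h (hIi (hSI hh)), one_mul]

theorem FollowsCFR.gain_le (hcfr : Γ.FollowsCFR i σ) (hΓ : Γ.NearlyWellFormed Γ' k l)
    (hσ : ∀ t, 1 ≤ t → Γ.IsProfile (σ t)) {s : Behavior α} (hs : Γ'.IsStrategy i s) :
    gain (G := G) i σ T s ≤
      G.utilRange i * Γ.mergeConst Γ' i k l * √((Γ.maxActions i : ℝ) * T) := by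
  have hpart : ∀ F : List α → ℝ, ∑ h ∈ G.playerHist i, F h = ∑ I ∈ Γ.sets i, ∑ h ∈ I, F h := by
    intro F
    rw [sum_eq_sum_refinedSets (Γ' := Γ) subset_rfl fun g hg =>
      subset_playerHist (infoSet_mem_sets hg)]
    refine Finset.sum_congr ?_ fun _ _ => rfl
    exact Finset.filter_true_of_mem fun I hI => subset_playerHist hI
  have hgain : gain (G := G) i σ T s = ∑ I ∈ Γ.sets i, ∑ t ∈ Finset.Icc 1 T, ∑ h ∈ I,
      G.own i s [] h *
        (∑ a ∈ G.actions h, s h a * G.histValue i (σ t) (h ++ [a]) - G.histValue i (σ t) h) := by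
    rw [gain, Finset.sum_comm]
    exact Finset.sum_congr rfl fun t _ => by rw [expectedUtil_update_sub, hpart]
  rw [hgain, mergeConst, NNReal.coe_sum, Finset.mul_sum, Finset.sum_mul]
  refine Finset.sum_le_sum fun I hI => ?_
  have hΔ := utilRange_nonneg (G := G) i
  -- Null sets are treated apart because their entry in `mergeConst` may be less than 1; they
  -- contribute nothing to the gain.
  by_cases hn : G.IsNull i I
  · refine le_trans (le_of_eq ?_) (by positivity)
    refine Finset.sum_eq_zero fun t ht => Finset.sum_eq_zero fun h hh => ?_
    have hσt := hσ t (Finset.mem_Icc.1 ht).1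
    rw [histValue_eq_zero hσt hn hh List.prefix_rfl, Finset.sum_eq_zero fun a _ => by
      rw [histValue_eq_zero hσt hn hh (List.prefix_append _ _), mul_zero]]
    simp
  · refine (hcfr.sum_gain_le hΓ hσ hs hI).trans ?_
    -- The diagonal entry of a non-null refined set equals 1.
    have h1 : (1 : ℝ≥0) ≤ (refinedSets Γ' i I ×ˢ refinedSets Γ' i I).sup
        fun p => k p.1 p.2 * l p.1 p.2 := by
      obtain ⟨h, hh⟩ := nonempty_of_mem_sets hI
      have hS : Γ'.infoSet h ∈ refinedSets Γ' i I :=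
        mem_refinedSets.2 ⟨infoSet_mem_sets (subset_playerHist hI hh), hΓ.1.infoSet_subset hI hh⟩
      obtain ⟨φ, ψ, ω, m⟩ := hΓ.exists_isMatching hI hS hS
      have := m.eq_one (by positivity) (pos_of_not_isNull hΓ hI hn hS hS).2
      have h2 : k (Γ'.infoSet h) (Γ'.infoSet h) * l (Γ'.infoSet h) (Γ'.infoSet h) = 1 := by
        exact_mod_cast this
      rw [← h2]
      exact Finset.le_sup (f := fun p : Finset (List α) × Finset (List α) => k p.1 p.2 * l p.1 p.2)
        (b := (Γ'.infoSet h, Γ'.infoSet h)) (Finset.mk_mem_product hS hS)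
    have h2 : (G.actionsAt I).card ≤ Γ.maxActions i :=
      Finset.le_sup (f := fun I => (G.actionsAt I).card) hI
    refine mul_le_mul (le_mul_of_one_le_right hΔ (by exact_mod_cast h1)) ?_ (by positivity)
      (by positivity)
    gcongr

end Info
end ExtensiveForm
end

theorem theorem3 {N α : Type*} [DecidableEq N] [Fintype α] [DecidableEq α]
    (G : ExtensiveForm.GameTree N α) (Γ Γ' : ExtensiveForm.Info G)
    (k l : Finset (List α) → Finset (List α) → ℝ≥0)
    (hΓ : Γ.NearlyWellFormed Γ' k l)
    (i : N) (σ : ℕ → N → ExtensiveForm.Behavior α)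
    (hσ : ∀ t, 1 ≤ t → Γ.IsProfile (σ t))
    (hcfr : Γ.FollowsCFR i σ)
    (T : ℕ) (hT : 1 ≤ T) :
    Γ'.regret i σ T / T ≤
      G.utilRange i * Γ.mergeConst Γ' i k l * √(Γ.maxActions i : ℝ) / √(T : ℝ) := by
  have hΔ := ExtensiveForm.GameTree.utilRange_nonneg (G := G) i
  have hT0 : (0 : ℝ) < T := by exact_mod_cast hT
  have h1 : Γ'.regret i σ T ≤
      G.utilRange i * Γ.mergeConst Γ' i k l * √((Γ.maxActions i : ℝ) * T) := by
    -- Nonnegativity of the bound covers the default value 0 of the supremum of an empty set.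
    refine Real.sSup_le ?_ (by positivity)
    rintro x ⟨s, hs, rfl⟩
    exact hcfr.gain_le hΓ hσ hs
  rw [div_le_div_iff₀ hT0 (Real.sqrt_pos.2 hT0)]
  calc Γ'.regret i σ T * √(T : ℝ)
      ≤ G.utilRange i * Γ.mergeConst Γ' i k l * √((Γ.maxActions i : ℝ) * T) * √(T : ℝ) :=
        mul_le_mul_of_nonneg_right h1 (Real.sqrt_nonneg _)
    _ = G.utilRange i * Γ.mergeConst Γ' i k l * √(Γ.maxActions i : ℝ) * (√(T : ℝ) * √(T : ℝ)) := by
        rw [Real.sqrt_mul (by positivity)]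
        ring
    _ = _ := by rw [Real.mul_self_sqrt hT0.le]
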